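/- **Adam.** Given a stochastic gradient map $g:\mathbb R^d\times\Xi\to\mathbb R^d$ (jointly measurable; written $\nabla f(x,\xi)$), random samples $\xi_1,\xi_2,\dots$ with values in $\Xi$, a starting point $x_1\in\mathbb R^d$ and parameters $\beta\in(0,1]$, $\beta_{\rm sq}\in[0,1]$, $\eta>0$, $\lambda>0$, put $m_0=v_0=0$ and for $t=1,2,\dots$ $$m_t=(1-\beta)m_{t-1}+\beta\,\nabla f(x_t,\xi_t),\quad v_t=(1-\beta_{\rm sq})v_{t-1}+\beta_{\rm sq}\,(\nabla f(x_t,\xi_t))^2,$$ $$\hat m_t=\frac{m_t}{1-(1-\beta)^t},\quad \hat v_t=\frac{v_t}{1-(1-\beta_{\rm sq})^t},\quad x_{t+1}=x_t-\frac{\eta}{\sqrt{\hat v_t}+\lambda}\odot\hat m_t,$$ with squares, roots, quotients and $\odot$ taken coordinatewise, and $\hat v_t=0$ if $\beta_{\rm sq}=0$. **Assumptions.** Let $L_0,L_\rho,\sigma\ge0$, $0\le\rho<1$, $\lambda>0$. (i) $f$ is real-valued and twice differentiable on an open set $D\subseteq\mathbb R^d$ containing $x_1$, $\inf_D f>-\infty$,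 and $\|\nabla^2f(x)\|\le L_0+L_\rho\|\nabla f(x)\|^\rho$ for almost every $x\in D$ (Euclidean and spectral norm). (ii) For all $t\ge1$, $\mathbb E[\nabla f(x_t,\xi_t)\mid\xi_1,\dots,\xi_{t-1}]=\nabla f(x_t)$ and $\|\nabla f(x_t,\xi_t)-\nabla f(x_t)\|\le\sigma$ almost surely. (iii) Almost surely the segments $[x_t,x_{t+1}]$, $t\ge1$, lie in $D$ (this is automatic if $D=\mathbb R^d$). Put $\Delta_1=f(x_1)-\inf_Df$, $\iota=\log(1/\delta)$ and, for $G>0$, $$r=\min\Big\{\frac1{5L_\rho G^{\rho-1}},\ \frac1{5(L_0^{\rho-1}L_\rho)^{1/\rho}}\Big\},\qquad L=3L_0+4L_\rho G^\rho,$$ where a positive number divided by $0$ is $+\infty$ and the second term of $r$ is omitted if $\rho=0$ or $L_0=0$. **Theorem.** Let $0<\delta_0<1$. If $C_1,C_2$ are large enough, depending only on $\delta_0$, and then $c_1,c_2>0$ are small enough, depending only on $\delta_0,C_1,C_2$, the following holds. (a) Let $d$, $f$, $D$, $x_1$, the samples and the stochastic gradients be as above, let $0<\delta\le\delta_0$,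 $\varepsilon>0$, and let $$G\ge\max\Big\{2\lambda,\ 2\sigma,\ 2\|\nabla f(x_1)\|,\ C_1\Delta_1L_0/\lambda,\ (C_1\Delta_1L_\rho/\lambda)^{\frac1{1-\rho}}\Big\}.$$ Choose $0\le\beta_{\rm sq}\le1$ and $$0<\beta\le\min\Big\{1,\frac{c_1\lambda\varepsilon^2}{\sigma^2G\sqrt\iota}\Big\},\quad 0<\eta\le c_2\min\Big\{\frac{r\lambda}{G},\frac{\lambda^2\beta}{GL\sqrt\iota}\Big\},\quad T=\Big\lceil\max\Big\{\frac1{\beta^2},\frac{C_2\Delta_1G}{\eta\varepsilon^2}\Big\}\Big\rceil.$$ Then, with probability at least $1-\delta$, $\|\nabla f(x_t)\|\le G$ for every $1\le t\le T$ and $$\frac1T\sum_{t=1}^T\|\nabla f(x_t)\|^2\le\varepsilon^2.$$ (b) (Dimension-free $O(\varepsilon^{-4})$ complexity.) For all $L_0,L_\rho,\rho,\sigma,\lambda$ as above, $0<\delta\le\delta_0$, $G>0$ and $\Delta_1\ge0$ there is a constant $K$, depending on these and on $c_1,c_2,C_2$ but not on $d$ or $\varepsilon$, such that for every $0<\varepsilon\le1$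 there are $\beta,\eta$ satisfying the conditions in (a) for which $T\le K\varepsilon^{-4}$. -/

import Mathlib

open MeasureTheory
open scoped ENNReal

noncomputable section

namespace AdamConv

/-- `ℝ^d` with the Euclidean norm. -/
abbrev Vec (d : ℕ) : Type := EuclideanSpace ℝ (Fin d)

/-! ### The algorithm -/

/-- The variables that Adam carries: the current iterate and the two (uncorrected) momenta. -/
structure State (d : ℕ) where
  x : Vec d
  m : Vec d
  v : Vec d

/-- Iteration number `t ≥ 1` of Adam with stochastic gradient map `g`, sample `ξ`, momentum
parameters `β`, `βsq`, stepsize `η` and regularizer `lam`.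
If `βsq = 0` then `v = 0`, and the corrected second momentum `v / (1 - (1 - βsq) ^ t)` is
read as `0` as well. -/
def step {d : ℕ} {Ξ : Type*} (g : Vec d → Ξ → Vec d) (β βsq η lam : ℝ)
    (t : ℕ) (ξ : Ξ) (s : State d) : State d :=
  let grad : Vec d := g s.x ξ
  let m : Vec d := (1 - β) • s.m + β • grad
  let v : Vec d := WithLp.toLp 2 fun i => (1 - βsq) * s.v i + βsq * (grad i) ^ 2
  let mhat : Vec d := WithLp.toLp 2 fun i => m i / (1 - (1 - β) ^ t)
  let vhat : Vec d := WithLp.toLp 2 fun i => v i / (1 - (1 - βsq) ^ t)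
  { x := WithLp.toLp 2 fun i => s.x i - η / (Real.sqrt (vhat i) + lam) * mhat i
    m := m
    v := v }

/-- The state after `t` iterations, which use the samples `ξ 1, …, ξ t`. -/
def run {d : ℕ} {Ξ : Type*} (g : Vec d → Ξ → Vec d) (β βsq η lam : ℝ) (xinit : Vec d)
    (ξ : ℕ → Ξ) : ℕ → State d
  | 0 => { x := xinit, m := 0, v := 0 }
  | t + 1 => step g β βsq η lam (t + 1) (ξ (t + 1)) (run g β βsq η lam xinit ξ t)

/-- The iterate `x_t` for `t ≥ 1`: `x_1 = xinit`, and `x_{t+1}` is produced by iteration `t`. -/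
def iterate {d : ℕ} {Ξ : Type*} (g : Vec d → Ξ → Vec d) (β βsq η lam : ℝ) (xinit : Vec d)
    (ξ : ℕ → Ξ) (t : ℕ) : Vec d :=
  (run g β βsq η lam xinit ξ (t - 1)).x

/-! ### The objective and the noise -/

/-- `f` is twice differentiable on its (open) domain `D`, and
`‖∇² f(x)‖ ≤ L₀ + Lρ ‖∇ f(x)‖ ^ ρ` for almost every `x ∈ D`. -/
structure IsL0LrhoSmoothOn {d : ℕ} (f : Vec d → ℝ) (D : Set (Vec d)) (L₀ Lρ ρ : ℝ) : Prop where
  differentiable : ∀ x ∈ D, DifferentiableAt ℝ f x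
  twice_differentiable : ∀ x ∈ D, DifferentiableAt ℝ (gradient f) x
  hessian_bound : ∀ᵐ x ∂(volume.restrict D),
    ‖fderiv ℝ (gradient f) x‖ ≤ L₀ + Lρ * ‖gradient f x‖ ^ ρ

/-- The σ-algebra generated by `ξ_1, …, ξ_{t-1}`. -/
@[reducible] def past {Ω Ξ : Type*} [MeasurableSpace Ξ] (ξ : ℕ → Ω → Ξ) (t : ℕ) : MeasurableSpace Ω :=
  ⨆ s ∈ {s : ℕ | 1 ≤ s ∧ s < t}, MeasurableSpace.comap (ξ s) inferInstance

/-- For every `t ≥ 1` the stochastic gradient at `X_t` is conditionally unbiased given the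
previous samples, and its error is almost surely at most `σ`. -/
structure BoundedNoise {d : ℕ} {Ω Ξ : Type*} [MeasurableSpace Ω] [MeasurableSpace Ξ]
    (μ : Measure Ω) (f : Vec d → ℝ) (g : Vec d → Ξ → Vec d) (ξ : ℕ → Ω → Ξ)
    (X : ℕ → Ω → Vec d) (σ : ℝ) : Prop where
  unbiased : ∀ t : ℕ, 1 ≤ t →
    μ[fun ω => g (X t ω) (ξ t ω) | past ξ t] =ᵐ[μ] fun ω => gradient f (X t ω)
  bounded : ∀ t : ℕ, 1 ≤ t →
    ∀ᵐ ω ∂μ, ‖g (X t ω) (ξ t ω) - gradient f (X t ω)‖ ≤ σ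

/-! ### Constants and parameters -/

/-- The initial gap `f(x_1) - inf_{x ∈ D} f(x)`. -/
def gap {d : ℕ} (f : Vec d → ℝ) (D : Set (Vec d)) (xinit : Vec d) : ℝ :=
  f xinit - sInf (f '' D)

/-- `r = min {1 / (5 Lρ G^{ρ-1}), 1 / (5 (L₀^{ρ-1} Lρ)^{1/ρ})}` in `[0, ∞]`, where `1 / 0 = ∞`.
The second term has no meaning if `ρ = 0` or `L₀ = 0` (as `ρ < 1`), and is then left out. -/
def radius (L₀ Lρ ρ G : ℝ) : ℝ≥0∞ :=
  min (1 / (5 * ENNReal.ofReal Lρ * ENNReal.ofReal G ^ (ρ - 1)))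
    (if ρ = 0 ∨ L₀ = 0 then ⊤
      else 1 / (5 * (ENNReal.ofReal L₀ ^ (ρ - 1) * ENNReal.ofReal Lρ) ^ (1 / ρ)))

/-- The effective smoothness constant `L = 3 L₀ + 4 Lρ G^ρ`. -/
def effSmooth (L₀ Lρ ρ G : ℝ) : ℝ := 3 * L₀ + 4 * Lρ * G ^ ρ

/-- The conditions on `β` and `η`, with `ι = log (1/δ)`. The right-hand sides are computed in
`[0, ∞]`, so that a fraction with positive numerator and denominator `0` is `∞`. -/
structure Admissible (c₁ c₂ δ ε σ lam L₀ Lρ ρ G β η : ℝ) : Prop where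
  β_pos : 0 < β
  η_pos : 0 < η
  β_le : ENNReal.ofReal β ≤
    min 1 (ENNReal.ofReal (c₁ * lam * ε ^ 2) /
      ENNReal.ofReal (σ ^ 2 * G * Real.sqrt (Real.log (1 / δ))))
  η_le : ENNReal.ofReal η ≤
    ENNReal.ofReal c₂ *
      min (radius L₀ Lρ ρ G * ENNReal.ofReal lam / ENNReal.ofReal G)
        (ENNReal.ofReal (lam ^ 2 * β) /
          ENNReal.ofReal (G * effSmooth L₀ Lρ ρ G * Real.sqrt (Real.log (1 / δ))))

/-- The number of iterations `T = max {1/β², C₂ Δ₁ G / (η ε²)}`, rounded up to an integer. -/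
def horizon (C₂ Δ₁ G ε β η : ℝ) : ℕ :=
  ⌈max (1 / β ^ 2) (C₂ * Δ₁ * G / (η * ε ^ 2))⌉₊

end AdamConv

end

/-!
As long as the gradients stay below `G`, the coordinates of a step of Adam are those of the
bias-corrected momentum, scaled by factors between `η / (2 G)` and `η / λ`. The bias-corrected
momentum is a weighted average of the past stochastic gradients, so it differs from the current
gradient by a lag, which is at most the averaged length of the recent steps and is paid for by the
descent since `η ≪ β`, and by averaged noise. The squared norm of the averaged noise, summed over
time, is of order `σ² β T` up to a sum of bounded real martingale differences. Azuma's inequality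
for this scalar sum does not see the dimension.

The bound `G` maintains itself. The almost everywhere bound on the Hessian makes the gradient
locally Lipschitz, so climbing from `G / 2` to `G` takes many short steps at gradient norm at least
`G / 2`, and these would already exceed the bound on `∑ ‖∇f(x_t)‖²` given by the descent.
-/

noncomputable section

namespace AdamConv

open Filter Topology Set ProbabilityTheory

/-! ### Smoothness -/

section AlmostEverywhereBounds

variable {E F : Type*} [NormedAddCommGroup E] [NormedSpace ℝ E]
  [NormedAddCommGroup F] [NormedSpace ℝ F]

lemma hasDerivAt_comp_add_smul {h : E → F} {y w : E} {s : ℝ}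
    (hd : DifferentiableAt ℝ h (y + s • w)) :
    HasDerivAt (fun s : ℝ => h (y + s • w)) (fderiv ℝ h (y + s • w) w) s := by
  have hline : HasDerivAt (fun s : ℝ => y + s • w) w s := by
    simpa using ((hasDerivAt_id s).smul_const w).const_add y
  exact hd.hasFDerivAt.comp_hasDerivAt s hline

variable [CompleteSpace F]

lemma norm_image_sub_le_of_ae_norm_deriv_le {φ : ℝ → F} {a b B : ℝ}
    (hφ : ∀ s ∈ uIcc a b, DifferentiableAt ℝ φ s)
    (hB : ∀ᵐ s : ℝ, s ∈ uIoc a b → ‖deriv φ s‖ ≤ B) : ‖φ b - φ a‖ ≤ B * |b - a| := by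
  have hderiv : IntervalIntegrable (deriv φ) volume a b :=
    intervalIntegrable_const.mono_fun' (aestronglyMeasurable_deriv φ _)
      ((ae_restrict_iff' measurableSet_uIoc).2 hB)
  rw [← intervalIntegral.integral_eq_sub_of_hasDerivAt (fun s hs => (hφ s hs).hasDerivAt) hderiv]
  exact intervalIntegral.norm_integral_le_of_norm_le_const_ae hB

variable [FiniteDimensional ℝ E] [MeasurableSpace E] [BorelSpace E] {ν : Measure E}
  [ν.IsAddHaarMeasure] {h : E → F} {U : Set E} {B : ℝ}

-- By Fubini, almost every line parallel to `w` meets the exceptional null set in a null set.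
lemma ae_norm_image_add_sub_le_of_ae_norm_fderiv_le (hd : ∀ x ∈ U, DifferentiableAt ℝ h x)
    (hB : ∀ᵐ x ∂ν, x ∈ U → ‖fderiv ℝ h x‖ ≤ B) (w : E) :
    ∀ᵐ y ∂ν, segment ℝ y (y + w) ⊆ U → ‖h (y + w) - h y‖ ≤ B * ‖w‖ := by
  obtain ⟨A, hA, hAm, hAB⟩ := hB.exists_measurable_mem
  have hlines := (ae_ae_add_linearMap_mem_iff (LinearMap.toSpanSingleton ℝ E w)
    (volume : Measure ℝ) ν hAm).2 hA
  filter_upwards [hlines] with y hy hseg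
  have hmem : ∀ s ∈ Icc (0 : ℝ) 1, y + s • w ∈ U := fun s hs =>
    hseg (by rw [segment_eq_image']; exact ⟨s, hs, by simp⟩)
  have hcurve := norm_image_sub_le_of_ae_norm_deriv_le (φ := fun s : ℝ => h (y + s • w))
    (a := 0) (b := 1) (B := B * ‖w‖)
    (fun s hs => (hasDerivAt_comp_add_smul
      (hd _ (hmem s (by rwa [uIcc_of_le zero_le_one] at hs)))).differentiableAt) (by
    filter_upwards [hy] with s hsA hs
    rw [uIoc_of_le zero_le_one] at hs
    have hsU := hmem s (Ioc_subset_Icc_self hs)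
    rw [(hasDerivAt_comp_add_smul (hd _ hsU)).deriv]
    exact (fderiv ℝ h _).le_of_opNorm_le (hAB _ hsA hsU) w)
  simpa using hcurve

lemma norm_image_sub_le_of_ae_norm_fderiv_le (ν : Measure E) [ν.IsAddHaarMeasure]
    (hU : IsOpen U) (hconv : Convex ℝ U)
    (hd : ∀ x ∈ U, DifferentiableAt ℝ h x) (hB : ∀ᵐ x ∂ν, x ∈ U → ‖fderiv ℝ h x‖ ≤ B)
    {x y : E} (hx : x ∈ U) (hy : y ∈ U) : ‖h y - h x‖ ≤ B * ‖y - x‖ := by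
  have hxy : x + (y - x) = y := add_sub_cancel x y
  have hnear : ∀ᶠ z in 𝓝 x, z ∈ U ∧ z + (y - x) ∈ U := by
    have hadd : Tendsto (fun z => z + (y - x)) (𝓝 x) (𝓝 y) := by
      have hcont : Continuous fun z : E => z + (y - x) := by fun_prop
      simpa only [hxy] using hcont.tendsto x
    exact (hU.eventually_mem hx).and (hadd.eventually (hU.eventually_mem hy))
  have hdense := Measure.dense_of_ae
    (ae_norm_image_add_sub_le_of_ae_norm_fderiv_le hd hB (y - x)) x
  have hfreq : ∃ᶠ z in 𝓝 x, ‖h (z + (y - x)) - h z‖ ≤ B * ‖y - x‖ :=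
    ((mem_closure_iff_frequently.1 hdense).and_eventually hnear).mono
      fun z hz => hz.1 (hconv.segment_subset hz.2.1 hz.2.2)
  have hcont : ContinuousAt (fun z => ‖h (z + (y - x)) - h z‖) x := by
    have hshift : ContinuousAt (fun z => h (z + (y - x))) x :=
      ContinuousAt.comp (g := h) (by rw [hxy]; exact (hd y hy).continuousAt) (by fun_prop)
    exact (hshift.sub (hd x hx).continuousAt).norm
  simpa only [hxy] using le_of_tendsto_of_frequently hcont hfreq

lemma norm_fderiv_le_of_ae_norm_fderiv_le (ν : Measure E) [ν.IsAddHaarMeasure] {x : E}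
    (hB₀ : 0 ≤ B) (hU : U ∈ 𝓝 x)
    (hd : ∀ x ∈ U, DifferentiableAt ℝ h x) (hB : ∀ᵐ x ∂ν, x ∈ U → ‖fderiv ℝ h x‖ ≤ B) :
    ‖fderiv ℝ h x‖ ≤ B := by
  obtain ⟨R, hR, hRU⟩ := Metric.mem_nhds_iff.1 hU
  refine norm_fderiv_le_of_lip' ℝ hB₀ ?_
  filter_upwards [Metric.ball_mem_nhds x hR] with y hy
  exact norm_image_sub_le_of_ae_norm_fderiv_le ν Metric.isOpen_ball (convex_ball x R)
    (fun z hz => hd z (hRU hz)) (hB.mono fun z hz hzR => hz (hRU hzR))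
    (Metric.mem_ball_self hR) hy

end AlmostEverywhereBounds

lemma IsL0LrhoSmoothOn.norm_fderiv_gradient_le {d : ℕ} {f : Vec d → ℝ} {D : Set (Vec d)}
    {L₀ Lρ ρ : ℝ} (hf : IsL0LrhoSmoothOn f D L₀ Lρ ρ) (hD : IsOpen D)
    (hL₀ : 0 ≤ L₀) (hLρ : 0 ≤ Lρ) (hρ : 0 ≤ ρ) {x : Vec d} (hx : x ∈ D) :
    ‖fderiv ℝ (gradient f) x‖ ≤ L₀ + Lρ * ‖gradient f x‖ ^ ρ := by
  have hbound : ∀ M > ‖gradient f x‖, ‖fderiv ℝ (gradient f) x‖ ≤ L₀ + Lρ * M ^ ρ := by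
    intro M hM
    have hM₀ : 0 ≤ M := (norm_nonneg _).trans hM.le
    have hU : D ∩ {y | ‖gradient f y‖ < M} ∈ 𝓝 x :=
      inter_mem (hD.mem_nhds hx)
        ((hf.twice_differentiable x hx).continuousAt.norm.eventually_lt_const hM)
    refine norm_fderiv_le_of_ae_norm_fderiv_le volume (by positivity) hU
      (fun y hy => hf.twice_differentiable y hy.1) ?_
    filter_upwards [(ae_restrict_iff' hD.measurableSet).1 hf.hessian_bound] with y hy hyU
    refine (hy hyU.1).trans ?_
    gcongr
    exact le_of_lt hyU.2
  have hcont : Continuous fun M : ℝ => L₀ + Lρ * M ^ ρ := by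
    have := Real.continuous_rpow_const hρ
    fun_prop
  refine ge_of_tendsto (x := 𝓝[>] ‖gradient f x‖)
    ((hcont.tendsto _).mono_left nhdsWithin_le_nhds) ?_
  filter_upwards [self_mem_nhdsWithin] with M hM using hbound M hM

lemma norm_image_sub_le_of_norm_deriv_le_of_norm_le {F : Type*} [NormedAddCommGroup F]
    [NormedSpace ℝ F] {u u' : ℝ → F} {a b C M : ℝ} (hab : a ≤ b)
    (hu : ∀ s ∈ Icc a b, HasDerivWithinAt u (u' s) (Icc a b) s) (hC₀ : 0 ≤ C)
    (hC : ∀ s ∈ Ico a b, ‖u s‖ ≤ M → ‖u' s‖ ≤ C) (hM : ‖u a‖ + C * (b - a) < M) :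
    ‖u b - u a‖ ≤ C * (b - a) := by
  have : 0 ≤ b - a := sub_nonneg.2 hab
  -- a slope slightly larger than `C` still keeps the barrier below `M`
  obtain ⟨C', hCC', hC'M⟩ : ∃ C' > C, ‖u a‖ + C' * (b - a) ≤ M := by
    have hlim : Tendsto (fun c => ‖u a‖ + c * (b - a)) (𝓝[>] C) (𝓝 (‖u a‖ + C * (b - a))) :=
      (Continuous.tendsto (by fun_prop) C).mono_left nhdsWithin_le_nhds
    obtain ⟨C', hC', hlt⟩ := (eventually_mem_nhdsWithin.and (hlim.eventually_lt_const hM)).exists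
    exact ⟨C', hC', hlt.le⟩
  have hbarrier : ∀ s ∈ Icc a b, ‖u a‖ + C' * (s - a) ≤ M := fun s hs => by
    have : C' * (s - a) ≤ C' * (b - a) := by gcongr; exacts [hC₀.trans hCC'.le, hs.2]
    linarith
  have hnorm : ∀ s ∈ Icc a b, ‖u s‖ ≤ ‖u a‖ + C' * (s - a) := by
    refine image_norm_le_of_norm_deriv_right_lt_deriv_boundary' (f' := u') (B' := fun _ => C')
      (fun s hs => (hu s hs).continuousWithinAt)
      (fun s hs => (hu s (Ico_subset_Icc_self hs)).mono_of_mem_nhdsWithin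
        (Icc_mem_nhdsGE_of_mem hs))
      (by simp) (by fun_prop) (fun s _ => ?_) (fun s hs heq => ?_)
    · simpa using ((((hasDerivAt_id s).sub_const a).const_mul C').const_add ‖u a‖).hasDerivWithinAt
    · exact (hC s hs (heq.le.trans (hbarrier s (Ico_subset_Icc_self hs)))).trans_lt hCC'
  exact norm_image_sub_le_of_norm_deriv_le_segment' hu
    (fun s hs => hC s hs ((hnorm s (Ico_subset_Icc_self hs)).trans
      (hbarrier s (Ico_subset_Icc_self hs)))) b ⟨hab, le_rfl⟩

section Threshold

variable {L₀ Lρ ρ G s : ℝ}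

lemma two_mul_rpow_le {x : ℝ} (hx : 0 ≤ x) (hρ : ρ ≤ 1) : (2 * x) ^ ρ ≤ 2 * x ^ ρ := by
  rw [Real.mul_rpow two_pos.le hx]
  gcongr
  simpa using Real.rpow_le_rpow_of_exponent_le one_le_two hρ

lemma effSmooth_nonneg (hL₀ : 0 ≤ L₀) (hLρ : 0 ≤ Lρ) (hG : 0 ≤ G) :
    0 ≤ effSmooth L₀ Lρ ρ G := by
  unfold effSmooth
  positivity

lemma five_mul_rpow_le_of_le_radius (hLρ : 0 ≤ Lρ) (hG : 0 < G) (hs : 0 ≤ s)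
    (hr : ENNReal.ofReal s ≤ radius L₀ Lρ ρ G) : 5 * (s * (Lρ * G ^ ρ)) ≤ G := by
  have hone : s * (5 * Lρ * G ^ (ρ - 1)) ≤ 1 := by
    have := ENNReal.mul_le_of_le_div (hr.trans (min_le_left _ _))
    rw [ENNReal.ofReal_rpow_of_pos hG, ← ENNReal.ofReal_ofNat, ← ENNReal.ofReal_mul (by positivity),
      ← ENNReal.ofReal_mul (by positivity), ← ENNReal.ofReal_mul hs] at this
    exact ENNReal.ofReal_le_one.1 this
  calc 5 * (s * (Lρ * G ^ ρ)) = s * (5 * Lρ * G ^ (ρ - 1)) * G := by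
        rw [Real.rpow_sub_one hG.ne']; field_simp
    _ ≤ G := mul_le_of_le_one_left hG.le hone

lemma five_mul_le_of_le_radius (hL₀ : 0 < L₀) (hLρ : 0 < Lρ) (hρ : 0 < ρ) (hs : 0 ≤ s)
    (hr : ENNReal.ofReal s ≤ radius L₀ Lρ ρ G) : 5 * (s * L₀) ≤ (L₀ / Lρ) ^ (1 / ρ) := by
  have hone : s * (5 * (L₀ ^ (ρ - 1) * Lρ) ^ (1 / ρ)) ≤ 1 := by
    have := hr.trans (min_le_right _ _)
    rw [if_neg (by simp [hρ.ne', hL₀.ne'])] at this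
    replace this := ENNReal.mul_le_of_le_div this
    rw [ENNReal.ofReal_rpow_of_pos hL₀, ← ENNReal.ofReal_mul (by positivity),
      ENNReal.ofReal_rpow_of_pos (by positivity), ← ENNReal.ofReal_ofNat,
      ← ENNReal.ofReal_mul (by positivity), ← ENNReal.ofReal_mul hs] at this
    exact ENNReal.ofReal_le_one.1 this
  have hprod : (L₀ ^ (ρ - 1) * Lρ) ^ (1 / ρ) * (L₀ / Lρ) ^ (1 / ρ) = L₀ := by
    have hbase : L₀ ^ (ρ - 1) * Lρ * (L₀ / Lρ) = L₀ ^ ρ := by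
      rw [Real.rpow_sub_one hL₀.ne']; field_simp
    rw [← Real.mul_rpow (by positivity) (by positivity), hbase, one_div,
      Real.rpow_rpow_inv hL₀.le hρ.ne']
  calc 5 * (s * L₀) = s * (5 * (L₀ ^ (ρ - 1) * Lρ) ^ (1 / ρ)) * (L₀ / Lρ) ^ (1 / ρ) := by
        linear_combination -5 * s * hprod
    _ ≤ (L₀ / Lρ) ^ (1 / ρ) := mul_le_of_le_one_left (by positivity) hone

-- The threshold is the gradient norm at which `L₀` and `Lρ ‖∇f‖ ^ ρ` balance, or `G` if that is
-- larger.
lemma exists_gradient_threshold (hL₀ : 0 ≤ L₀) (hLρ : 0 ≤ Lρ) (hρ : 0 ≤ ρ) (hρ₁ : ρ < 1)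
    (hG : 0 < G) (hs : 0 ≤ s) (hr : ENNReal.ofReal s ≤ radius L₀ Lρ ρ G) :
    ∃ τ : ℝ, G ≤ τ ∧ L₀ + Lρ * (2 * τ) ^ ρ ≤ effSmooth L₀ Lρ ρ G ∧
      s * (L₀ + Lρ * (2 * τ) ^ ρ) < τ := by
  unfold effSmooth
  have hLG : 0 ≤ Lρ * G ^ ρ := by positivity
  have htwo : ∀ τ, 0 ≤ τ → Lρ * (2 * τ) ^ ρ ≤ 2 * (Lρ * τ ^ ρ) := fun τ hτ =>
    (mul_le_mul_of_nonneg_left (two_mul_rpow_le hτ hρ₁.le) hLρ).trans_eq (by ring)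
  rcases le_or_gt L₀ (Lρ * G ^ ρ) with hcase | hcase
  · refine ⟨G, le_rfl, by linarith [htwo G hG.le], ?_⟩
    have hbound : s * (L₀ + Lρ * (2 * G) ^ ρ) ≤ s * (3 * (Lρ * G ^ ρ)) := by
      gcongr
      linarith [htwo G hG.le]
    linarith [five_mul_rpow_le_of_le_radius hLρ hG hs hr]
  by_cases hconst : ρ = 0 ∨ Lρ = 0
  · have hindep : ∀ τ, Lρ * (2 * τ) ^ ρ = Lρ * G ^ ρ := by
      rcases hconst with rfl | rfl <;> simp
    refine ⟨max G (s * (L₀ + Lρ * G ^ ρ) + 1), le_max_left _ _, ?_, ?_⟩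
    · rw [hindep]; linarith
    · rw [hindep]; exact (lt_add_one _).trans_le (le_max_right _ _)
  obtain ⟨hρ_ne, hLρ_ne⟩ := not_or.1 hconst
  have hρ₀ : 0 < ρ := hρ.lt_of_ne' hρ_ne
  have hLρ₀ : 0 < Lρ := hLρ.lt_of_ne' hLρ_ne
  have hL₀₀ : 0 < L₀ := hLG.trans_lt hcase
  set τ : ℝ := (L₀ / Lρ) ^ (1 / ρ)
  have hτ : 0 < τ := by positivity
  have hbalance : Lρ * τ ^ ρ = L₀ := by
    simp only [τ, one_div]
    rw [Real.rpow_inv_rpow (by positivity) hρ_ne, mul_div_cancel₀ _ hLρ_ne]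
  have hGτ : G ≤ τ := by
    rw [← Real.rpow_le_rpow_iff hG.le hτ.le hρ₀]
    exact le_of_mul_le_mul_left (by linarith) hLρ₀
  refine ⟨τ, hGτ, by linarith [htwo τ hτ.le], ?_⟩
  have hbound : s * (L₀ + Lρ * (2 * τ) ^ ρ) ≤ s * (3 * L₀) := by
    gcongr
    linarith [htwo τ hτ.le]
  linarith [five_mul_le_of_le_radius hL₀₀ hLρ₀ hρ₀ hs hr]

end Threshold

/-- Local smoothness of `f` on `D` in the only form the analysis of the iteration needs: from a
point with gradient at most `G`, the gradient is `L`-Lipschitz along segments in `D` of length at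
most `R`. -/
structure IsSmoothNear {E : Type*} [NormedAddCommGroup E] [InnerProductSpace ℝ E] [CompleteSpace E]
    (f : E → ℝ) (D : Set E) (G R L : ℝ) : Prop where
  differentiableAt : ∀ x ∈ D, DifferentiableAt ℝ f x
  norm_gradient_sub_le : ∀ x y, segment ℝ x y ⊆ D → ‖gradient f x‖ ≤ G → ‖y - x‖ ≤ R →
    ‖gradient f y - gradient f x‖ ≤ L * ‖y - x‖

lemma IsSmoothNear.le_add_inner_add {E : Type*} [NormedAddCommGroup E] [InnerProductSpace ℝ E]
    [CompleteSpace E] {f : E → ℝ} {D : Set E} {G R L : ℝ} (hf : IsSmoothNear f D G R L)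
    (hL : 0 ≤ L) {x y : E} (hseg : segment ℝ x y ⊆ D) (hx : ‖gradient f x‖ ≤ G)
    (hxy : ‖y - x‖ ≤ R) :
    f y ≤ f x + inner ℝ (gradient f x) (y - x) + L * ‖y - x‖ ^ 2 := by
  have hbound : ∀ z ∈ segment ℝ x y,
      ‖InnerProductSpace.toDual ℝ E (gradient f z) -
        InnerProductSpace.toDual ℝ E (gradient f x)‖ ≤ L * ‖y - x‖ := by
    intro z hz
    rw [← map_sub, LinearIsometryEquiv.norm_map]
    have hzx : ‖z - x‖ ≤ ‖y - x‖ := by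
      obtain ⟨s, hs, rfl⟩ := segment_eq_image' ℝ x y ▸ hz
      rw [add_sub_cancel_left, norm_smul, Real.norm_of_nonneg hs.1]
      exact mul_le_of_le_one_left (norm_nonneg _) hs.2
    have hsub : segment ℝ x z ⊆ segment ℝ x y :=
      (convex_segment x y).segment_subset (left_mem_segment ℝ x y) hz
    refine (hf.norm_gradient_sub_le x z (hsub.trans hseg) hx (hzx.trans hxy)).trans ?_
    gcongr
  have htaylor := (convex_segment x y).norm_image_sub_le_of_norm_hasFDerivWithin_le'
    (fun z hz => (hf.differentiableAt z (hseg hz)).hasGradientAt.hasFDerivAt.hasFDerivWithinAt)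
    hbound (left_mem_segment ℝ x y) (right_mem_segment ℝ x y)
  rw [InnerProductSpace.toDual_apply_apply, mul_assoc, ← pow_two] at htaylor
  linarith [(le_abs_self _).trans htaylor]

lemma IsL0LrhoSmoothOn.isSmoothNear {d : ℕ} {f : Vec d → ℝ} {D : Set (Vec d)} {L₀ Lρ ρ G R : ℝ}
    (hf : IsL0LrhoSmoothOn f D L₀ Lρ ρ) (hD : IsOpen D) (hL₀ : 0 ≤ L₀) (hLρ : 0 ≤ Lρ)
    (hρ : 0 ≤ ρ) (hρ₁ : ρ < 1) (hG : 0 < G) (hR : ENNReal.ofReal R ≤ radius L₀ Lρ ρ G) :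
    IsSmoothNear f D G R (effSmooth L₀ Lρ ρ G) where
  differentiableAt := hf.differentiable
  norm_gradient_sub_le x y hseg hx hxy := by
    obtain ⟨τ, hGτ, hKL, hKτ⟩ := exists_gradient_threshold hL₀ hLρ hρ hρ₁ hG
      (norm_nonneg (y - x)) ((ENNReal.ofReal_le_ofReal hxy).trans hR)
    set K : ℝ := L₀ + Lρ * (2 * τ) ^ ρ
    have hK : 0 ≤ K := by have := hG.trans_le hGτ; positivity
    have hmem : ∀ s ∈ Icc (0 : ℝ) 1, x + s • (y - x) ∈ D := fun s hs =>
      hseg (by rw [segment_eq_image']; exact ⟨s, hs, rfl⟩)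
    -- The gradient along the segment cannot exceed `2 τ`: while it is below, it moves by less
    -- than `τ`.
    have hbootstrap := norm_image_sub_le_of_norm_deriv_le_of_norm_le (C := K * ‖y - x‖)
      (M := 2 * τ) (u := fun s : ℝ => gradient f (x + s • (y - x))) zero_le_one
      (fun s hs => (hasDerivAt_comp_add_smul
        (hf.twice_differentiable _ (hmem s hs))).hasDerivWithinAt)
      (by positivity)
      (fun s hs hsmall => (fderiv ℝ (gradient f) _).le_of_opNorm_le
        ((hf.norm_fderiv_gradient_le hD hL₀ hLρ hρ (hmem s (Ico_subset_Icc_self hs))).trans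
          (by simp only [K]; gcongr)) _)
      (by simp only [zero_smul, add_zero, sub_zero, mul_one]; linarith)
    simp only [one_smul, add_sub_cancel, zero_smul, add_zero, sub_zero, mul_one] at hbootstrap
    exact hbootstrap.trans (by gcongr)

/-! ### Weighted averages -/

section Average

variable {E : Type*} [NormedAddCommGroup E]

/-- The running averages of `w 0, w 1, …`, started at `0`, in which `w k` enters with weight `α k`:
the momentum of a sequence of gradients. -/
def average [Module ℝ E] (α : ℕ → ℝ) (w : ℕ → E) : ℕ → E
  | 0 => 0
  | k + 1 => (1 - α k) • average α w k + α k • w k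

lemma average_add [Module ℝ E] (α : ℕ → ℝ) (u n : ℕ → E) (k : ℕ) :
    average α (u + n) k = average α u k + average α n k := by
  induction k with
  | zero => simp [average]
  | succ k ih => simp only [average, ih, Pi.add_apply]; module

lemma norm_average_le [NormedSpace ℝ E] {α : ℕ → ℝ} {w : ℕ → E} {B : ℝ} (hα₀ : ∀ k, 0 ≤ α k)
    (hα₁ : ∀ k, α k ≤ 1) (hB : 0 ≤ B) (k : ℕ) (hw : ∀ j < k, ‖w j‖ ≤ B) :
    ‖average α w k‖ ≤ B := by
  induction k with
  | zero => simpa [average] using hB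
  | succ k ih =>
    have hα : 0 ≤ 1 - α k := sub_nonneg.2 (hα₁ k)
    calc ‖average α w (k + 1)‖ ≤ (1 - α k) * ‖average α w k‖ + α k * ‖w k‖ := by
          refine (norm_add_le _ _).trans_eq ?_
          rw [norm_smul, norm_smul, Real.norm_of_nonneg hα, Real.norm_of_nonneg (hα₀ k)]
      _ ≤ (1 - α k) * B + α k * B := by
          gcongr
          exacts [ih fun j hj => hw j (hj.trans k.lt_succ_self), hα₀ k, hw k k.lt_succ_self]
      _ = B := by ring

lemma mul_sum_norm_average_sub_sq_le [NormedSpace ℝ E] {α : ℕ → ℝ} {u : ℕ → E} {v : ℕ → ℝ}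
    {β : ℝ} (hβ : 0 < β) (hα : ∀ k, β ≤ α k) (hα₁ : ∀ k, α k ≤ 1) (hα_zero : α 0 = 1) (K : ℕ)
    (hu : ∀ k < K, ‖u (k + 1) - u k‖ ≤ v k) :
    β * ∑ k ∈ Finset.range K, ‖average α u (k + 1) - u k‖ ^ 2 + ‖average α u (K + 1) - u K‖ ^ 2 ≤
      (∑ k ∈ Finset.range K, v k ^ 2) / β := by
  induction K with
  | zero => simp [average, hα_zero]
  | succ K ih =>
    rw [Finset.sum_range_succ, Finset.sum_range_succ, add_div]
    have hprev := ih fun k hk => hu k (hk.trans K.lt_succ_self)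
    have hrec : average α u (K + 2) - u (K + 1) =
        (1 - α (K + 1)) • ((average α u (K + 1) - u K) - (u (K + 1) - u K)) := by
      rw [average]; module
    set x := ‖average α u (K + 1) - u K‖
    have hy : ‖u (K + 1) - u K‖ ≤ v K := hu K K.lt_succ_self
    have hnorm : ‖average α u (K + 2) - u (K + 1)‖ ≤ (1 - β) * (x + v K) := by
      rw [hrec, norm_smul, Real.norm_of_nonneg (sub_nonneg.2 (hα₁ _))]
      exact mul_le_mul (sub_le_sub_left (hα _) 1) ((norm_sub_le _ _).trans (by gcongr))
        (norm_nonneg _) (by linarith [hα (K + 1), hα₁ (K + 1)])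
    have hyoung : ((1 - β) * (x + v K)) ^ 2 ≤ (1 - β) * x ^ 2 + v K ^ 2 / β := by
      have hβ₁ : 0 ≤ 1 - β := by linarith [hα 0, hα₁ 0]
      rw [← sub_le_iff_le_add', le_div_iff₀ hβ]
      nlinarith [mul_nonneg hβ₁ (sq_nonneg (β * x - (1 - β) * v K)),
        mul_nonneg (mul_nonneg hβ.le (by linarith : 0 ≤ 2 - β)) (sq_nonneg (v K))]
    linarith [pow_le_pow_left₀ (norm_nonneg _) hnorm 2]

section Descent

variable [NormedSpace ℝ E] {α : ℕ → ℝ} {u n : ℕ → E} {β p : ℝ}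

lemma average_add_sub (α : ℕ → ℝ) (u n : ℕ → E) (k : ℕ) :
    average α (u + n) (k + 1) - u k =
      average α n (k + 1) + (average α u (k + 1) - u k) := by
  rw [average_add]; abel

lemma sum_norm_average_add_sub_sq_le (α : ℕ → ℝ) (u n : ℕ → E) (K : ℕ) :
    ∑ k ∈ Finset.range K, ‖average α (u + n) (k + 1) - u k‖ ^ 2 ≤
      2 * ∑ k ∈ Finset.range K, ‖average α n (k + 1)‖ ^ 2 +
        2 * ∑ k ∈ Finset.range K, ‖average α u (k + 1) - u k‖ ^ 2 := by
  rw [← mul_add, ← Finset.sum_add_distrib, Finset.mul_sum]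
  refine Finset.sum_le_sum fun k _ => ?_
  rw [average_add_sub]
  exact (pow_le_pow_left₀ (norm_nonneg _) (norm_add_le _ _) 2).trans add_sq_le

lemma sq_mul_sum_norm_average_sub_sq_le (hβ : 0 < β) (hα : ∀ k, β ≤ α k) (hα₁ : ∀ k, α k ≤ 1)
    (hα_zero : α 0 = 1) (hp : 6 * p ^ 2 ≤ β ^ 2) (K : ℕ)
    (hu : ∀ k < K, ‖u (k + 1) - u k‖ ≤ p * ‖average α (u + n) (k + 1)‖) :
    β ^ 2 * ∑ k ∈ Finset.range K, ‖average α u (k + 1) - u k‖ ^ 2 ≤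
      6 * p ^ 2 * (∑ k ∈ Finset.range K, ‖u k‖ ^ 2 +
        ∑ k ∈ Finset.range K, ‖average α n (k + 1)‖ ^ 2) := by
  set U := ∑ k ∈ Finset.range K, ‖u k‖ ^ 2
  set S := ∑ k ∈ Finset.range K, ‖average α n (k + 1)‖ ^ 2
  set R := ∑ k ∈ Finset.range K, ‖average α u (k + 1) - u k‖ ^ 2
  set M := ∑ k ∈ Finset.range K, ‖average α (u + n) (k + 1)‖ ^ 2
  have hR : 0 ≤ R := Finset.sum_nonneg fun _ _ => sq_nonneg _
  have hM : M ≤ 3 * U + 3 * S + 3 * R := by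
    simp only [M, U, S, R, Finset.mul_sum, ← Finset.sum_add_distrib]
    refine Finset.sum_le_sum fun k _ => ?_
    have hsplit : average α (u + n) (k + 1) =
        u k + average α n (k + 1) + (average α u (k + 1) - u k) := by
      rw [add_assoc, ← average_add_sub]; abel
    have hnorm := pow_le_pow_left₀ (norm_nonneg _) (hsplit ▸ norm_add₃_le) 2
    nlinarith [sq_nonneg (‖u k‖ - ‖average α n (k + 1)‖),
      sq_nonneg (‖u k‖ - ‖average α u (k + 1) - u k‖),
      sq_nonneg (‖average α n (k + 1)‖ - ‖average α u (k + 1) - u k‖)]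
  have hlag : β ^ 2 * R ≤ p ^ 2 * M := by
    have hdrift := (le_add_of_nonneg_right (sq_nonneg _)).trans
      (mul_sum_norm_average_sub_sq_le hβ hα hα₁ hα_zero K hu)
    simp only [mul_pow, ← Finset.mul_sum] at hdrift
    rwa [le_div_iff₀ hβ, mul_right_comm, ← pow_two] at hdrift
  nlinarith [mul_le_mul_of_nonneg_left hM (sq_nonneg p), mul_le_mul_of_nonneg_right hp hR]

lemma add_sum_norm_sq_le_of_descent {F : ℕ → ℝ} {a A : ℝ} (hβ : 0 < β) (hα : ∀ k, β ≤ α k)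
    (hα₁ : ∀ k, α k ≤ 1) (hα_zero : α 0 = 1) (hA : 0 ≤ A) (hp : 6 * p ^ 2 ≤ β ^ 2)
    (hpA : 24 * p ^ 2 * A ≤ a * β ^ 2) (K : ℕ)
    (hu : ∀ k < K, ‖u (k + 1) - u k‖ ≤ p * ‖average α (u + n) (k + 1)‖)
    (hF : ∀ k < K, F (k + 1) ≤ F k - a * ‖u k‖ ^ 2 +
      A * ‖average α (u + n) (k + 1) - u k‖ ^ 2) :
    F K + a / 2 * ∑ k ∈ Finset.range K, ‖u k‖ ^ 2 ≤
      F 0 + 4 * A * ∑ k ∈ Finset.range K, ‖average α n (k + 1)‖ ^ 2 := by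
  have hlag := sq_mul_sum_norm_average_sub_sq_le hβ hα hα₁ hα_zero hp K hu
  have herr := mul_le_mul_of_nonneg_left (sum_norm_average_add_sub_sq_le α u n K) hA
  have htelescope : F K - F 0 ≤ -(a * ∑ k ∈ Finset.range K, ‖u k‖ ^ 2) +
      A * ∑ k ∈ Finset.range K, ‖average α (u + n) (k + 1) - u k‖ ^ 2 := by
    rw [← Finset.sum_range_sub, Finset.mul_sum, Finset.mul_sum, ← Finset.sum_neg_distrib,
      ← Finset.sum_add_distrib]
    exact Finset.sum_le_sum fun k hk => by linarith [hF k (Finset.mem_range.1 hk)]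
  set U := ∑ k ∈ Finset.range K, ‖u k‖ ^ 2
  set S := ∑ k ∈ Finset.range K, ‖average α n (k + 1)‖ ^ 2
  set R := ∑ k ∈ Finset.range K, ‖average α u (k + 1) - u k‖ ^ 2
  have hU : 0 ≤ U := Finset.sum_nonneg fun _ _ => sq_nonneg _
  have hS : 0 ≤ S := Finset.sum_nonneg fun _ _ => sq_nonneg _
  have hlag' : 2 * A * R ≤ a / 2 * U + 2 * A * S := by
    refine le_of_mul_le_mul_left ?_ (pow_pos hβ 2)
    nlinarith [mul_le_mul_of_nonneg_left hlag hA, mul_le_mul_of_nonneg_right hpA hU,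
      mul_le_mul_of_nonneg_right hp (mul_nonneg hA hS)]
  linarith

end Descent

section CrossTerm

variable [InnerProductSpace ℝ E] {α : ℕ → ℝ} {n : ℕ → E} {β σ : ℝ}

/-- The mixed term in the expansion of `‖average α n (k + 1)‖ ^ 2`. For mean-zero noise `n` these
terms are martingale differences. -/
def crossTerm (α : ℕ → ℝ) (n : ℕ → E) (k : ℕ) : ℝ :=
  2 * α k * (1 - α k) * inner ℝ (average α n k) (n k)

lemma norm_average_succ_sq (α : ℕ → ℝ) (n : ℕ → E) (k : ℕ) :
    ‖average α n (k + 1)‖ ^ 2 =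
      (1 - α k) ^ 2 * ‖average α n k‖ ^ 2 + crossTerm α n k + α k ^ 2 * ‖n k‖ ^ 2 := by
  rw [average, norm_add_sq_real, norm_smul, norm_smul, mul_pow, mul_pow, real_inner_smul_left,
    real_inner_smul_right, Real.norm_eq_abs, Real.norm_eq_abs, sq_abs, sq_abs, crossTerm]
  ring

lemma abs_crossTerm_le (hα₀ : ∀ k, 0 ≤ α k) (hα₁ : ∀ k, α k ≤ 1) {k : ℕ}
    (hn : ∀ j ≤ k, ‖n j‖ ≤ σ) : |crossTerm α n k| ≤ 2 * α k * σ ^ 2 := by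
  have hσ : 0 ≤ σ := (norm_nonneg _).trans (hn k le_rfl)
  have havg : ‖average α n k‖ ≤ σ := norm_average_le hα₀ hα₁ hσ k fun j hj => hn j hj.le
  have hinner : |inner ℝ (average α n k) (n k)| ≤ σ ^ 2 := by
    rw [pow_two]
    exact (abs_real_inner_le_norm _ _).trans (mul_le_mul havg (hn k le_rfl) (norm_nonneg _) hσ)
  have hα : 0 ≤ 2 * α k := mul_nonneg two_pos.le (hα₀ k)
  rw [crossTerm, abs_mul, abs_of_nonneg (mul_nonneg hα (sub_nonneg.2 (hα₁ k)))]
  exact mul_le_mul (mul_le_of_le_one_right hα (sub_le_self _ (hα₀ k))) hinner (abs_nonneg _) hα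

lemma mul_sum_norm_average_sq_le (hβ : 0 ≤ β) (hα : ∀ k, β ≤ α k) (hα₁ : ∀ k, α k ≤ 1) (K : ℕ)
    (hn : ∀ k < K, ‖n k‖ ≤ σ) :
    β * ∑ k ∈ Finset.range K, ‖average α n (k + 1)‖ ^ 2 ≤
      ∑ k ∈ Finset.range K, crossTerm α n k + σ ^ 2 * ∑ k ∈ Finset.range K, α k ^ 2 := by
  have hβ₁ : 0 ≤ 1 - β := by linarith [hα 0, hα₁ 0]
  suffices β * ∑ k ∈ Finset.range K, ‖average α n (k + 1)‖ ^ 2 + (1 - β) * ‖average α n K‖ ^ 2 ≤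
      ∑ k ∈ Finset.range K, crossTerm α n k + σ ^ 2 * ∑ k ∈ Finset.range K, α k ^ 2 from
    (le_add_of_nonneg_right (by positivity)).trans this
  induction K with
  | zero => simp [average]
  | succ K ih =>
    simp only [Finset.sum_range_succ]
    have hprev := ih fun k hk => hn k (hk.trans K.lt_succ_self)
    have hfresh : α K ^ 2 * ‖n K‖ ^ 2 ≤ α K ^ 2 * σ ^ 2 := by
      gcongr; exact hn K K.lt_succ_self
    have hcontract : (1 - α K) ^ 2 * ‖average α n K‖ ^ 2 ≤ (1 - β) * ‖average α n K‖ ^ 2 := by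
      gcongr
      nlinarith [hα K, hα₁ K]
    linarith [norm_average_succ_sq α n K]

end CrossTerm

lemma norm_le_half_add_sum_sq {u : ℕ → E} {G ℓ : ℝ} (hG : 0 < G) (hℓ : 0 ≤ ℓ) (hℓG : ℓ ≤ G / 4)
    (h₀ : ‖u 0‖ ≤ G / 2) (K : ℕ) (hu : ∀ k < K, ‖u (k + 1) - u k‖ ≤ ℓ) :
    ‖u K‖ ≤ G / 2 + 16 * ℓ / G ^ 2 * ∑ k ∈ Finset.range K, ‖u k‖ ^ 2 := by
  induction K with
  | zero => simpa using h₀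
  | succ K ih =>
    have hprev := ih fun k hk => hu k (hk.trans K.lt_succ_self)
    have hstep : ‖u (K + 1)‖ ≤ ‖u K‖ + ℓ :=
      (norm_le_norm_add_norm_sub' _ _).trans (by gcongr; exact hu K K.lt_succ_self)
    rcases le_or_gt (G / 4) ‖u K‖ with hlarge | hsmall
    · have hpaid : ℓ ≤ 16 * ℓ / G ^ 2 * ‖u K‖ ^ 2 := by
        have hsq : (G / 4) ^ 2 ≤ ‖u K‖ ^ 2 := by gcongr
        rw [div_mul_eq_mul_div, le_div_iff₀ (by positivity)]
        nlinarith
      rw [Finset.sum_range_succ, mul_add]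
      linarith
    · have hsum : 0 ≤ 16 * ℓ / G ^ 2 * ∑ k ∈ Finset.range (K + 1), ‖u k‖ ^ 2 := by positivity
      linarith

end Average

section Weight

variable {β : ℝ}

/-- The weight with which the gradient number `k` (counted from `0`) enters the bias-corrected
momentum of Adam. -/
def weight (β : ℝ) (k : ℕ) : ℝ := β / (1 - (1 - β) ^ (k + 1))

lemma weight_zero (hβ : β ≠ 0) : weight β 0 = 1 := by simp [weight, hβ]

lemma one_sub_pow_succ_pos (hβ : 0 < β) (hβ₁ : β ≤ 1) (k : ℕ) : 0 < 1 - (1 - β) ^ (k + 1) :=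
  sub_pos.2 (pow_lt_one₀ (by linarith) (by linarith) k.succ_ne_zero)

lemma le_weight (hβ : 0 < β) (hβ₁ : β ≤ 1) (k : ℕ) : β ≤ weight β k := by
  rw [weight, le_div_iff₀ (one_sub_pow_succ_pos hβ hβ₁ k)]
  exact mul_le_of_le_one_right hβ.le (sub_le_self _ (pow_nonneg (by linarith) _))

lemma weight_le_one (hβ : 0 < β) (hβ₁ : β ≤ 1) (k : ℕ) : weight β k ≤ 1 := by
  rw [weight, div_le_one (one_sub_pow_succ_pos hβ hβ₁ k), le_sub_comm]
  exact pow_le_of_le_one (by linarith) (by linarith) k.succ_ne_zero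

lemma weight_le_add (hβ : 0 < β) (hβ₁ : β ≤ 1) (k : ℕ) : weight β k ≤ β + 1 / (k + 1) := by
  have hbernoulli : 1 + (k + 1) * β ≤ (1 + β) ^ (k + 1) := by
    exact_mod_cast one_add_mul_le_pow (a := β) (by linarith) (k + 1)
  have hprod : (1 - β) ^ (k + 1) * (1 + (k + 1) * β) ≤ 1 := by
    calc (1 - β) ^ (k + 1) * (1 + (k + 1) * β) ≤ (1 - β) ^ (k + 1) * (1 + β) ^ (k + 1) :=
          mul_le_mul_of_nonneg_left hbernoulli (pow_nonneg (by linarith) _)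
      _ = (1 - β ^ 2) ^ (k + 1) := by rw [← mul_pow]; ring
      _ ≤ 1 := pow_le_one₀ (by nlinarith) (by nlinarith)
  have hk : β + 1 / ((k : ℝ) + 1) = (1 + (k + 1) * β) / (k + 1) := by field_simp; ring
  rw [weight, div_le_iff₀ (one_sub_pow_succ_pos hβ hβ₁ k), hk, div_mul_eq_mul_div,
    le_div_iff₀ (by positivity)]
  linarith

lemma one_sub_pow_mul_one_sub_weight (hβ : 0 < β) (hβ₁ : β ≤ 1) (k : ℕ) :
    (1 - (1 - β) ^ (k + 1)) * (1 - weight β k) = (1 - β) * (1 - (1 - β) ^ k) := by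
  have := (one_sub_pow_succ_pos hβ hβ₁ k).ne'
  rw [weight]
  field_simp
  ring

lemma sum_weight_sq_le (hβ : 0 < β) (hβ₁ : β ≤ 1) (T : ℕ) :
    ∑ k ∈ Finset.range T, weight β k ^ 2 ≤ 2 * β ^ 2 * T + 4 := by
  have hterm : ∀ k, weight β k ^ 2 ≤ 2 * β ^ 2 + 2 * (((k + 1 : ℕ) : ℝ) ^ 2)⁻¹ := fun k => by
    have hle := pow_le_pow_left₀ (hβ.le.trans (le_weight hβ hβ₁ k)) (weight_le_add hβ hβ₁ k) 2
    refine (hle.trans add_sq_le).trans_eq ?_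
    push_cast
    rw [one_div, inv_pow]
    ring
  have hbasel : ∑ k ∈ Finset.range T, (((k + 1 : ℕ) : ℝ) ^ 2)⁻¹ ≤ 2 := by
    have hIoo : Finset.Ioo 0 (T + 1) = Finset.Ico 1 (T + 1) := rfl
    simpa [hIoo, Finset.sum_Ico_eq_sum_range, add_comm] using sum_Ioo_inv_sq_le (α := ℝ) 0 (T + 1)
  calc ∑ k ∈ Finset.range T, weight β k ^ 2
      ≤ ∑ k ∈ Finset.range T, (2 * β ^ 2 + 2 * (((k + 1 : ℕ) : ℝ) ^ 2)⁻¹) :=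
        Finset.sum_le_sum fun k _ => hterm k
    _ = 2 * β ^ 2 * T + 2 * ∑ k ∈ Finset.range T, (((k + 1 : ℕ) : ℝ) ^ 2)⁻¹ := by
        rw [Finset.sum_add_distrib, Finset.sum_const, Finset.card_range, nsmul_eq_mul,
          ← Finset.mul_sum, mul_comm (T : ℝ)]
    _ ≤ 2 * β ^ 2 * T + 4 := by linarith

end Weight

/-! ### Concentration -/

lemma exp_mul_le_cosh_add_sinh_div_mul {y c : ℝ} (hy : |y| ≤ c) (θ : ℝ) :
    Real.exp (θ * y) ≤ Real.cosh (θ * c) + Real.sinh (θ * c) / c * y := by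
  rcases ((abs_nonneg y).trans hy).eq_or_lt with rfl | hc
  · simp [abs_nonpos_iff.1 hy]
  · have hyc : |y / c| ≤ 1 := by rwa [abs_div, abs_of_pos hc, div_le_one hc]
    calc Real.exp (θ * y) = Real.exp (y / c * (θ * c)) := by congr 1; field_simp
      _ ≤ Real.cosh (θ * c) + y / c * Real.sinh (θ * c) :=
          Real.exp_mul_le_cosh_add_mul_sinh hyc _
      _ = Real.cosh (θ * c) + Real.sinh (θ * c) / c * y := by ring

section Concentration

variable {Ω : Type*} {m m₀ : MeasurableSpace Ω} {μ : Measure Ω}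

lemma integral_mul_exp_le_of_condExp_eq_zero [IsFiniteMeasure μ] (hm : m ≤ m₀) {Y Z : Ω → ℝ}
    {c : ℝ} (hZm : StronglyMeasurable[m] Z) (hZ : Integrable Z μ) (hZ₀ : 0 ≤ Z)
    (hY : AEStronglyMeasurable Y μ) (hYc : ∀ᵐ ω ∂μ, |Y ω| ≤ c) (hY₀ : μ[Y | m] =ᵐ[μ] 0) (θ : ℝ) :
    ∫ ω, Z ω * Real.exp (θ * Y ω) ∂μ ≤ Real.exp ((θ * c) ^ 2 / 2) * ∫ ω, Z ω ∂μ := by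
  have hZY : Integrable (fun ω => Z ω * Y ω) μ := hZ.mul_bdd (c := c) hY hYc
  have horth : ∫ ω, Z ω * Y ω ∂μ = 0 := by
    have hcond : μ[fun ω => Z ω * Y ω | m] =ᵐ[μ] 0 := by
      filter_upwards [condExp_mul_of_stronglyMeasurable_left hZm hZY (.of_bound hY c hYc), hY₀]
        with ω hpull hω
      exact hpull.trans (by simp [hω])
    rw [← integral_condExp hm, integral_congr_ae hcond]
    simp
  calc ∫ ω, Z ω * Real.exp (θ * Y ω) ∂μ
      ≤ ∫ ω, (Real.cosh (θ * c) * Z ω + Real.sinh (θ * c) / c * (Z ω * Y ω)) ∂μ := by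
        refine integral_mono_of_nonneg
          (ae_of_all _ fun ω => mul_nonneg (hZ₀ ω) (Real.exp_pos _).le)
          ((hZ.const_mul _).add (hZY.const_mul _)) (hYc.mono fun ω hω => ?_)
        calc Z ω * Real.exp (θ * Y ω)
            ≤ Z ω * (Real.cosh (θ * c) + Real.sinh (θ * c) / c * Y ω) :=
              mul_le_mul_of_nonneg_left (exp_mul_le_cosh_add_sinh_div_mul hω θ) (hZ₀ ω)
          _ = _ := by ring
    _ = Real.cosh (θ * c) * ∫ ω, Z ω ∂μ := by
        rw [integral_add (hZ.const_mul _) (hZY.const_mul _), integral_const_mul,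
          integral_const_mul, horth, mul_zero, add_zero]
    _ ≤ Real.exp ((θ * c) ^ 2 / 2) * ∫ ω, Z ω ∂μ :=
        mul_le_mul_of_nonneg_right (Real.cosh_le_exp_half_sq _) (integral_nonneg hZ₀)

-- Mathlib's `HasCondSubgaussianMGF` needs a standard Borel space; conditional expectations do not.
lemma hasSubgaussianMGF_add_of_condExp_eq_zero [IsFiniteMeasure μ] (hm : m ≤ m₀) {X Y : Ω → ℝ}
    {v : NNReal} {c : ℝ} (hXm : StronglyMeasurable[m] X) (hX : HasSubgaussianMGF X v μ)
    (hY : AEStronglyMeasurable Y μ) (hYc : ∀ᵐ ω ∂μ, |Y ω| ≤ c) (hY₀ : μ[Y | m] =ᵐ[μ] 0) :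
    HasSubgaussianMGF (X + Y) (v + ‖c‖₊ ^ 2) μ where
  integrable_exp_mul θ := by
    simp only [Pi.add_apply, mul_add, Real.exp_add]
    refine (hX.integrable_exp_mul θ).mul_bdd (c := Real.exp (|θ| * c))
      (Real.continuous_exp.comp_aestronglyMeasurable (hY.const_mul θ)) (hYc.mono fun ω hω => ?_)
    rw [Real.norm_of_nonneg (Real.exp_pos _).le, Real.exp_le_exp]
    calc θ * Y ω ≤ |θ| * |Y ω| := (le_abs_self _).trans_eq (abs_mul _ _)
      _ ≤ |θ| * c := by gcongr
  mgf_le θ := by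
    calc mgf (X + Y) μ θ = ∫ ω, Real.exp (θ * X ω) * Real.exp (θ * Y ω) ∂μ := by
          simp only [mgf, Pi.add_apply, mul_add, Real.exp_add]
      _ ≤ Real.exp ((θ * c) ^ 2 / 2) * mgf X μ θ :=
          integral_mul_exp_le_of_condExp_eq_zero hm
            (Real.continuous_exp.comp_stronglyMeasurable (hXm.const_mul θ))
            (hX.integrable_exp_mul θ) (fun _ => (Real.exp_pos _).le) hY hYc hY₀ θ
      _ ≤ Real.exp ((θ * c) ^ 2 / 2) * Real.exp (v * θ ^ 2 / 2) := by gcongr; exact hX.mgf_le θ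
      _ = Real.exp (↑(v + ‖c‖₊ ^ 2) * θ ^ 2 / 2) := by
          rw [← Real.exp_add]
          push_cast
          rw [Real.norm_eq_abs, sq_abs]
          ring_nf

lemma measure_sqrt_lt_le_of_hasSubgaussianMGF [IsFiniteMeasure μ] {X : Ω → ℝ} {v : NNReal}
    (hX : HasSubgaussianMGF X v μ) {V ι : ℝ} (hV : v ≤ V) (hι : 0 ≤ ι) :
    μ {ω | √(2 * V * ι) < X ω} ≤ ENNReal.ofReal (Real.exp (-ι)) := by
  rcases eq_or_ne v 0 with rfl | hv
  · have hnull : ∀ᵐ ω ∂μ, ¬ √(2 * V * ι) < X ω := by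
      filter_upwards [hX.ae_eq_zero_of_hasSubgaussianMGF_zero] with ω hω
      rw [hω]
      exact not_lt.2 (Real.sqrt_nonneg _)
    have hzero : μ {ω | √(2 * V * ι) < X ω} = 0 := by simpa using ae_iff.1 hnull
    simp [hzero]
  · have hv₀ : (0 : ℝ) < v := NNReal.coe_pos.2 (pos_iff_ne_zero.2 hv)
    rw [← ENNReal.ofReal_toReal (measure_ne_top μ _)]
    refine ENNReal.ofReal_le_ofReal ?_
    calc μ.real {ω | √(2 * V * ι) < X ω} ≤ μ.real {ω | √(2 * V * ι) ≤ X ω} :=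
          measureReal_mono (ofPred_subset_ofPred.2 fun _ => le_of_lt)
      _ ≤ Real.exp (-√(2 * V * ι) ^ 2 / (2 * v)) := hX.measure_ge_le (Real.sqrt_nonneg _)
      _ ≤ Real.exp (-ι) := by
          rw [Real.sq_sqrt (by have := hv₀.le.trans hV; positivity), Real.exp_le_exp, neg_div,
            neg_le_neg_iff, le_div_iff₀ (by positivity)]
          linarith [mul_le_mul_of_nonneg_right hV hι]

end Concentration

/-- `n 0, n 1, …` is a martingale difference sequence for `ℱ`, shifted by one: `n k` is known at
time `k + 1` and has mean zero given `ℱ k`. Moreover `‖n k‖ ≤ c k` almost surely. -/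
structure IsBoundedMartingaleDiff {Ω E : Type*} {m₀ : MeasurableSpace Ω} [NormedAddCommGroup E]
    [NormedSpace ℝ E] [CompleteSpace E] (μ : Measure Ω) (ℱ : Filtration ℕ m₀) (n : ℕ → Ω → E)
    (c : ℕ → ℝ) : Prop where
  stronglyMeasurable (k : ℕ) : StronglyMeasurable[ℱ (k + 1)] (n k)
  condExp (k : ℕ) : μ[n k | ℱ k] =ᵐ[μ] 0
  bound (k : ℕ) : ∀ᵐ ω ∂μ, ‖n k ω‖ ≤ c k

namespace IsBoundedMartingaleDiff

variable {Ω : Type*} {m₀ : MeasurableSpace Ω} {μ : Measure Ω} {ℱ : Filtration ℕ m₀}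

lemma hasSubgaussianMGF_sum [IsProbabilityMeasure μ] {Y : ℕ → Ω → ℝ} {c : ℕ → ℝ}
    (hY : IsBoundedMartingaleDiff μ ℱ Y c) (T : ℕ) :
    HasSubgaussianMGF (fun ω => ∑ k ∈ Finset.range T, Y k ω)
      (∑ k ∈ Finset.range T, ‖c k‖₊ ^ 2) μ := by
  induction T with
  | zero => simp only [Finset.range_zero, Finset.sum_empty, HasSubgaussianMGF.fun_zero]
  | succ T ih =>
    simp only [Finset.sum_range_succ]
    have hsum : StronglyMeasurable[ℱ T] fun ω => ∑ k ∈ Finset.range T, Y k ω :=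
      Finset.stronglyMeasurable_fun_sum _ fun k hk =>
        (hY.stronglyMeasurable k).mono (ℱ.mono (Finset.mem_range.1 hk))
    exact hasSubgaussianMGF_add_of_condExp_eq_zero (ℱ.le T) hsum ih
      ((hY.stronglyMeasurable T).mono (ℱ.le _)).aestronglyMeasurable (hY.bound T) (hY.condExp T)

variable {E : Type*} [NormedAddCommGroup E] [InnerProductSpace ℝ E] [CompleteSpace E]
  {n : ℕ → Ω → E} {c : ℕ → ℝ} {α : ℕ → ℝ}

lemma stronglyMeasurable_average (hn : IsBoundedMartingaleDiff μ ℱ n c) (α : ℕ → ℝ) (k : ℕ) :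
    StronglyMeasurable[ℱ k] fun ω => average α (fun j => n j ω) k := by
  induction k with
  | zero => exact stronglyMeasurable_const
  | succ k ih =>
    exact ((ih.mono (ℱ.mono k.le_succ)).const_smul _).add ((hn.stronglyMeasurable k).const_smul _)

lemma crossTerm [IsFiniteMeasure μ] {σ : ℝ} (hn : IsBoundedMartingaleDiff μ ℱ n fun _ => σ)
    (hα₀ : ∀ k, 0 ≤ α k) (hα₁ : ∀ k, α k ≤ 1) :
    IsBoundedMartingaleDiff μ ℱ (fun k ω => crossTerm α (fun j => n j ω) k)
      fun k => 2 * α k * σ ^ 2 := by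
  have hmeas (k : ℕ) :
      StronglyMeasurable[ℱ (k + 1)] fun ω => AdamConv.crossTerm α (fun j => n j ω) k :=
    (((hn.stronglyMeasurable_average α k).mono (ℱ.mono k.le_succ)).inner
      (hn.stronglyMeasurable k)).const_mul _
  have hbound (k : ℕ) :
      ∀ᵐ ω ∂μ, ‖AdamConv.crossTerm α (fun j => n j ω) k‖ ≤ 2 * α k * σ ^ 2 :=
    (ae_all_iff.2 hn.bound).mono fun ω hω => abs_crossTerm_le hα₀ hα₁ fun j _ => hω j
  refine ⟨hmeas, fun k => ?_, hbound⟩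
  have hbilin : (fun ω => AdamConv.crossTerm α (fun j => n j ω) k) = fun ω =>
      innerSL ℝ ((2 * α k * (1 - α k)) • average α (fun j => n j ω) k) (n k ω) := by
    funext ω
    rw [innerSL_apply_apply, real_inner_smul_left, AdamConv.crossTerm]
  have hcross : Integrable (fun ω => AdamConv.crossTerm α (fun j => n j ω) k) μ :=
    .of_bound ((hmeas k).mono (ℱ.le _)).aestronglyMeasurable _ (hbound k)
  rw [hbilin] at hcross ⊢
  filter_upwards [condExp_bilin_of_stronglyMeasurable_left (innerSL ℝ)
    ((hn.stronglyMeasurable_average α k).const_smul _) hcross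
    (.of_bound ((hn.stronglyMeasurable k).mono (ℱ.le _)).aestronglyMeasurable σ (hn.bound k)),
    hn.condExp k] with ω hpull hω
  exact hpull.trans (by simp [hω])

lemma measure_lt_mul_sum_norm_average_sq_le [IsProbabilityMeasure μ] {σ β A ι : ℝ}
    (hn : IsBoundedMartingaleDiff μ ℱ n fun _ => σ) (hβ : 0 ≤ β) (hα : ∀ k, β ≤ α k)
    (hα₁ : ∀ k, α k ≤ 1) {T : ℕ} (hA : ∑ k ∈ Finset.range T, α k ^ 2 ≤ A) (hι : 0 ≤ ι) :
    μ {ω | σ ^ 2 * (A + √(8 * A * ι)) <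
        β * ∑ k ∈ Finset.range T, ‖average α (fun j => n j ω) (k + 1)‖ ^ 2} ≤
      ENNReal.ofReal (Real.exp (-ι)) := by
  have hcross := hn.crossTerm (fun k => hβ.trans (hα k)) hα₁
  have hvariance : ((∑ k ∈ Finset.range T, ‖2 * α k * σ ^ 2‖₊ ^ 2 : NNReal) : ℝ) ≤
      4 * σ ^ 4 * A := by
    push_cast
    refine le_trans (le_of_eq ?_) (mul_le_mul_of_nonneg_left hA (by positivity))
    rw [Finset.mul_sum]
    exact Finset.sum_congr rfl fun k _ => by rw [Real.norm_eq_abs, sq_abs]; ring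
  refine (measure_mono_ae ?_).trans
    (measure_sqrt_lt_le_of_hasSubgaussianMGF (hcross.hasSubgaussianMGF_sum T) hvariance hι)
  filter_upwards [ae_all_iff.2 hn.bound] with ω hω hlt
  have hsqrt : √(2 * (4 * σ ^ 4 * A) * ι) = σ ^ 2 * √(8 * A * ι) := by
    rw [show 2 * (4 * σ ^ 4 * A) * ι = (σ ^ 2) ^ 2 * (8 * A * ι) by ring,
      Real.sqrt_mul (by positivity), Real.sqrt_sq (by positivity)]
  have hsum := mul_sum_norm_average_sq_le hβ hα hα₁ T fun k _ => hω k
  have hsq : σ ^ 2 * ∑ k ∈ Finset.range T, α k ^ 2 ≤ σ ^ 2 * A := by gcongr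
  change √(2 * (4 * σ ^ 4 * A) * ι) < ∑ k ∈ Finset.range T, AdamConv.crossTerm α (fun j => n j ω) k
  rw [hsqrt]
  linarith [show _ < _ from hlt]

end IsBoundedMartingaleDiff

/-! ### Coordinatewise scaled descent with momentum -/

section ScaledStep

variable {ι : Type*} {lo hi : ℝ} {x y m : EuclideanSpace ℝ ι}

/-- `y` is obtained from `x` by a step against `m`, with a stepsize in `[lo, hi]` that may differ
between coordinates. -/
def IsScaledStep (lo hi : ℝ) (x m y : EuclideanSpace ℝ ι) : Prop :=
  ∀ i, ∃ h ∈ Icc lo hi, y i = x i - h * m i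

namespace IsScaledStep

variable [Fintype ι]

lemma norm_sub_le (hy : IsScaledStep lo hi x m y) (hlo : 0 ≤ lo) (hhi : 0 ≤ hi) :
    ‖y - x‖ ≤ hi * ‖m‖ := by
  choose h hh hyx using hy
  refine le_of_sq_le_sq ?_ (by positivity)
  rw [mul_pow, EuclideanSpace.real_norm_sq_eq, EuclideanSpace.real_norm_sq_eq, Finset.mul_sum]
  refine Finset.sum_le_sum fun i _ => ?_
  calc (y - x) i ^ 2 = h i ^ 2 * m i ^ 2 := by rw [PiLp.sub_apply, hyx]; ring
    _ ≤ hi ^ 2 * m i ^ 2 := by gcongr; exacts [hlo.trans (hh i).1, (hh i).2]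

lemma inner_sub_add_norm_sq_le {L : ℝ} (hy : IsScaledStep lo hi x m y) (hlo : 0 ≤ lo) (hL : 0 ≤ L)
    (hLhi : L * hi ≤ 1 / 8) (u : EuclideanSpace ℝ ι) :
    inner ℝ u (y - x) + L * ‖y - x‖ ^ 2 ≤ -(lo / 4) * ‖u‖ ^ 2 + hi * ‖m - u‖ ^ 2 := by
  choose h hh hyx using hy
  simp only [EuclideanSpace.real_norm_sq_eq, PiLp.inner_apply, PiLp.sub_apply, Finset.mul_sum,
    ← Finset.sum_add_distrib, RCLike.inner_apply, conj_trivial]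
  refine Finset.sum_le_sum fun i _ => ?_
  obtain ⟨e, he⟩ : ∃ e, m i = u i + e := ⟨m i - u i, by ring⟩
  have hh₀ : 0 ≤ h i := hlo.trans (hh i).1
  have hLh : L * h i ≤ 1 / 8 := (mul_le_mul_of_nonneg_left (hh i).2 hL).trans hLhi
  have hyoung : -(u i + e) * u i + 1 / 8 * (u i + e) ^ 2 ≤ -(1 / 4) * u i ^ 2 + e ^ 2 := by
    nlinarith [sq_nonneg (u i + e), sq_nonneg (u i + 2 * e)]
  calc (y i - x i) * u i + L * (y i - x i) ^ 2
      = h i * (-(u i + e) * u i + L * h i * (u i + e) ^ 2) := by rw [hyx, he]; ring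
    _ ≤ h i * (-(u i + e) * u i + 1 / 8 * (u i + e) ^ 2) := by gcongr
    _ ≤ h i * (-(1 / 4) * u i ^ 2 + e ^ 2) := by gcongr
    _ = -(1 / 4) * (h i * u i ^ 2) + h i * e ^ 2 := by ring
    _ ≤ -(1 / 4) * (lo * u i ^ 2) + hi * e ^ 2 := by
        linarith [mul_le_mul_of_nonneg_right (hh i).1 (sq_nonneg (u i)),
          mul_le_mul_of_nonneg_right (hh i).2 (sq_nonneg e)]
    _ = -(lo / 4) * u i ^ 2 + hi * (m i - u i) ^ 2 := by rw [he]; ring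

end IsScaledStep

end ScaledStep

/-- Descent along the running averages of noisy gradients `∇ f (X k) + n k`, which enter with
weights `α k`, by coordinatewise stepsizes in `[lo, hi]`. The stepsizes are controlled only as long
as the gradients are bounded by `G`. -/
structure IsMomentumDescent {ι : Type*} [Fintype ι] (f : EuclideanSpace ℝ ι → ℝ)
    (D : Set (EuclideanSpace ℝ ι)) (α : ℕ → ℝ) (lo hi G : ℝ) (X n : ℕ → EuclideanSpace ℝ ι) :
    Prop where
  segment_subset (k : ℕ) : segment ℝ (X k) (X (k + 1)) ⊆ D
  norm_noise_le (k : ℕ) : ‖n k‖ ≤ G / 2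
  step (k : ℕ) : (∀ j ≤ k, ‖gradient f (X j)‖ ≤ G) →
    IsScaledStep lo hi (X k) (average α ((fun j => gradient f (X j)) + n) (k + 1)) (X (k + 1))

lemma sq_mul_le_and_mul_le_of_lag {lo hi L β : ℝ} (hβ : 0 < β) (hβ₁ : β ≤ 1) (hlo : 0 < lo)
    (hlohi : lo ≤ hi) (hlag : 96 * (L * hi) ^ 2 * hi ≤ lo * β ^ 2) :
    96 * (L * hi) ^ 2 ≤ β ^ 2 ∧ L * hi ≤ 1 / 8 := by
  have hsq : 96 * (L * hi) ^ 2 ≤ β ^ 2 := by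
    refine le_of_mul_le_mul_right (hlag.trans ?_) (hlo.trans_le hlohi)
    rw [mul_comm]
    gcongr
  exact ⟨hsq, by nlinarith⟩

namespace IsMomentumDescent

variable {ι : Type*} [Fintype ι] {f : EuclideanSpace ℝ ι → ℝ} {D : Set (EuclideanSpace ℝ ι)}
  {α : ℕ → ℝ} {lo hi G β L : ℝ} {X n : ℕ → EuclideanSpace ℝ ι}

lemma G_nonneg (hX : IsMomentumDescent f D α lo hi G X n) : 0 ≤ G := by
  linarith [norm_nonneg (n 0), hX.norm_noise_le 0]

lemma mem (hX : IsMomentumDescent f D α lo hi G X n) (k : ℕ) : X k ∈ D :=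
  hX.segment_subset k (left_mem_segment ℝ _ _)

lemma norm_average_le (hX : IsMomentumDescent f D α lo hi G X n) (hα₀ : ∀ k, 0 ≤ α k)
    (hα₁ : ∀ k, α k ≤ 1) {k : ℕ} (hk : ∀ j ≤ k, ‖gradient f (X j)‖ ≤ G) :
    ‖average α ((fun j => gradient f (X j)) + n) (k + 1)‖ ≤ 3 / 2 * G := by
  refine AdamConv.norm_average_le hα₀ hα₁ (by linarith [hX.G_nonneg]) _ fun j hj => ?_
  refine (norm_add_le _ _).trans ?_
  linarith [hk j (Nat.lt_succ_iff.1 hj), hX.norm_noise_le j]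

lemma norm_sub_le (hX : IsMomentumDescent f D α lo hi G X n) (hα₀ : ∀ k, 0 ≤ α k)
    (hα₁ : ∀ k, α k ≤ 1) (hlo : 0 ≤ lo) (hhi : 0 ≤ hi) {k : ℕ}
    (hk : ∀ j ≤ k, ‖gradient f (X j)‖ ≤ G) : ‖X (k + 1) - X k‖ ≤ hi * (3 / 2 * G) :=
  ((hX.step k hk).norm_sub_le hlo hhi).trans
    (mul_le_mul_of_nonneg_left (hX.norm_average_le hα₀ hα₁ hk) hhi)

lemma norm_gradient_sub_le (hX : IsMomentumDescent f D α lo hi G X n)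
    (hf : IsSmoothNear f D G (hi * (3 / 2 * G)) L) (hL : 0 ≤ L) (hα₀ : ∀ k, 0 ≤ α k)
    (hα₁ : ∀ k, α k ≤ 1) (hlo : 0 ≤ lo) (hhi : 0 ≤ hi) {k : ℕ}
    (hk : ∀ j ≤ k, ‖gradient f (X j)‖ ≤ G) :
    ‖gradient f (X (k + 1)) - gradient f (X k)‖ ≤
      L * hi * ‖average α ((fun j => gradient f (X j)) + n) (k + 1)‖ := by
  calc ‖gradient f (X (k + 1)) - gradient f (X k)‖ ≤ L * ‖X (k + 1) - X k‖ :=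
        hf.norm_gradient_sub_le _ _ (hX.segment_subset k) (hk k le_rfl)
          (hX.norm_sub_le hα₀ hα₁ hlo hhi hk)
    _ ≤ L * (hi * ‖average α ((fun j => gradient f (X j)) + n) (k + 1)‖) := by
        gcongr
        exact (hX.step k hk).norm_sub_le hlo hhi
    _ = _ := by ring

lemma apply_succ_le (hX : IsMomentumDescent f D α lo hi G X n)
    (hf : IsSmoothNear f D G (hi * (3 / 2 * G)) L) (hL : 0 ≤ L) (hα₀ : ∀ k, 0 ≤ α k)
    (hα₁ : ∀ k, α k ≤ 1) (hlo : 0 ≤ lo) (hhi : 0 ≤ hi) (hLhi : L * hi ≤ 1 / 8) {k : ℕ}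
    (hk : ∀ j ≤ k, ‖gradient f (X j)‖ ≤ G) :
    f (X (k + 1)) ≤ f (X k) - lo / 4 * ‖gradient f (X k)‖ ^ 2 +
      hi * ‖average α ((fun j => gradient f (X j)) + n) (k + 1) - gradient f (X k)‖ ^ 2 := by
  have hmodel := hf.le_add_inner_add hL (hX.segment_subset k) (hk k le_rfl)
    (hX.norm_sub_le hα₀ hα₁ hlo hhi hk)
  linarith [(hX.step k hk).inner_sub_add_norm_sq_le hlo hL hLhi (gradient f (X k))]

lemma add_sum_norm_gradient_sq_le (hX : IsMomentumDescent f D α lo hi G X n)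
    (hf : IsSmoothNear f D G (hi * (3 / 2 * G)) L) (hL : 0 ≤ L) (hβ : 0 < β)
    (hα : ∀ k, β ≤ α k) (hα₁ : ∀ k, α k ≤ 1) (hα_zero : α 0 = 1) (hlo : 0 < lo) (hlohi : lo ≤ hi)
    (hlag : 96 * (L * hi) ^ 2 * hi ≤ lo * β ^ 2) {K : ℕ}
    (hK : ∀ k < K, ‖gradient f (X k)‖ ≤ G) :
    f (X K) + lo / 8 * ∑ k ∈ Finset.range K, ‖gradient f (X k)‖ ^ 2 ≤
      f (X 0) + 4 * hi * ∑ k ∈ Finset.range K, ‖average α n (k + 1)‖ ^ 2 := by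
  have hα₀ k : 0 ≤ α k := hβ.le.trans (hα k)
  have hhi : 0 ≤ hi := hlo.le.trans hlohi
  obtain ⟨hsq, hLhi⟩ := sq_mul_le_and_mul_le_of_lag hβ ((hα 0).trans (hα₁ 0)) hlo hlohi hlag
  have hsum := add_sum_norm_sq_le_of_descent (F := fun k => f (X k))
    (u := fun k => gradient f (X k)) (n := n) (a := lo / 4) hβ hα hα₁ hα_zero hhi
    (by linarith [sq_nonneg (L * hi)]) (by linarith) K
    (fun k hk => hX.norm_gradient_sub_le hf hL hα₀ hα₁ hlo.le hhi fun j hj => hK j (hj.trans_lt hk))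
    fun k hk => hX.apply_succ_le hf hL hα₀ hα₁ hlo.le hhi hLhi fun j hj => hK j (hj.trans_lt hk)
  rwa [div_div, show (4 : ℝ) * 2 = 8 by norm_num] at hsum

lemma norm_gradient_le_of_sum_le (hX : IsMomentumDescent f D α lo hi G X n)
    (hf : IsSmoothNear f D G (hi * (3 / 2 * G)) L) (hL : 0 ≤ L) (hG : 0 < G)
    (hα₀ : ∀ k, 0 ≤ α k) (hα₁ : ∀ k, α k ≤ 1) (hlo : 0 < lo) (hhi : 0 ≤ hi)
    (hLhi : L * hi ≤ 1 / 8) (hG₀ : ‖gradient f (X 0)‖ ≤ G / 2) {K : ℕ} {B : ℝ}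
    (hK : ∀ k < K, ‖gradient f (X k)‖ ≤ G)
    (hsum : lo / 8 * ∑ k ∈ Finset.range K, ‖gradient f (X k)‖ ^ 2 ≤ B)
    (hB : 384 * (L * hi) * B ≤ lo * G ^ 2) : ‖gradient f (X K)‖ ≤ G := by
  have hdrift : ∀ k < K, ‖gradient f (X (k + 1)) - gradient f (X k)‖ ≤
      L * hi * (3 / 2 * G) := fun k hk => by
    have hk' : ∀ j ≤ k, ‖gradient f (X j)‖ ≤ G := fun j hj => hK j (hj.trans_lt hk)
    refine (hX.norm_gradient_sub_le hf hL hα₀ hα₁ hlo.le hhi hk').trans ?_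
    gcongr
    exact hX.norm_average_le hα₀ hα₁ hk'
  have hdrift_le : L * hi * (3 / 2 * G) ≤ G / 4 := by
    linarith [mul_le_mul_of_nonneg_right hLhi hG.le]
  calc ‖gradient f (X K)‖
      ≤ G / 2 + 16 * (L * hi * (3 / 2 * G)) / G ^ 2 *
          ∑ k ∈ Finset.range K, ‖gradient f (X k)‖ ^ 2 :=
        norm_le_half_add_sum_sq (u := fun k => gradient f (X k)) hG (by positivity) hdrift_le
          hG₀ K hdrift
    _ = G / 2 + 192 * (L * hi) / (lo * G) *
          (lo / 8 * ∑ k ∈ Finset.range K, ‖gradient f (X k)‖ ^ 2) := by field_simp; ring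
    _ ≤ G / 2 + 192 * (L * hi) / (lo * G) * B := by gcongr
    _ ≤ G / 2 + G / 2 := by
        gcongr
        rw [div_mul_eq_mul_div, div_le_iff₀ (by positivity)]
        linarith
    _ = G := add_halves G

theorem norm_gradient_le_and_sum_le (hX : IsMomentumDescent f D α lo hi G X n)
    (hf : IsSmoothNear f D G (hi * (3 / 2 * G)) L) (hL : 0 ≤ L) (hG : 0 < G) (hβ : 0 < β)
    (hα : ∀ k, β ≤ α k) (hα₁ : ∀ k, α k ≤ 1) (hα_zero : α 0 = 1) (hlo : 0 < lo) (hlohi : lo ≤ hi)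
    (hlag : 96 * (L * hi) ^ 2 * hi ≤ lo * β ^ 2) {Δ S : ℝ} {T : ℕ}
    (hΔ : ∀ x ∈ D, f (X 0) - Δ ≤ f x) (hG₀ : ‖gradient f (X 0)‖ ≤ G / 2)
    (hS : ∑ k ∈ Finset.range T, ‖average α n (k + 1)‖ ^ 2 ≤ S)
    (hbudget : 384 * (L * hi) * (Δ + 4 * hi * S) ≤ lo * G ^ 2) :
    (∀ k < T, ‖gradient f (X k)‖ ≤ G) ∧
      lo / 8 * ∑ k ∈ Finset.range T, ‖gradient f (X k)‖ ^ 2 ≤ Δ + 4 * hi * S := by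
  have hhi : 0 ≤ hi := hlo.le.trans hlohi
  have hLhi := (sq_mul_le_and_mul_le_of_lag hβ ((hα 0).trans (hα₁ 0)) hlo hlohi hlag).2
  have hsum : ∀ K ≤ T, (∀ k < K, ‖gradient f (X k)‖ ≤ G) →
      lo / 8 * ∑ k ∈ Finset.range K, ‖gradient f (X k)‖ ^ 2 ≤ Δ + 4 * hi * S := by
    intro K hKT hK
    have hdescent := hX.add_sum_norm_gradient_sq_le hf hL hβ hα hα₁ hα_zero hlo hlohi hlag hK
    have hnoise : ∑ k ∈ Finset.range K, ‖average α n (k + 1)‖ ^ 2 ≤ S :=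
      (Finset.sum_le_sum_of_subset_of_nonneg (Finset.range_mono hKT)
        fun _ _ _ => sq_nonneg _).trans hS
    linarith [hΔ _ (hX.mem K), mul_le_mul_of_nonneg_left hnoise (by positivity : 0 ≤ 4 * hi)]
  have hall : ∀ K ≤ T, ∀ k < K, ‖gradient f (X k)‖ ≤ G := by
    intro K
    induction K with
    | zero => simp
    | succ K ih =>
      intro hKT
      have hK := ih (Nat.le_of_succ_le hKT)
      exact Nat.forall_lt_succ_right.2 ⟨hK, hX.norm_gradient_le_of_sum_le hf hL hG
        (fun k => hβ.le.trans (hα k)) hα₁ hlo hhi hLhi hG₀ hK (hsum K (Nat.le_of_succ_le hKT) hK)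
        hbudget⟩
  exact ⟨hall T le_rfl, hsum T le_rfl (hall T le_rfl)⟩

end IsMomentumDescent

/-! ### The run of Adam -/

section Run

variable {d : ℕ} {Ξ : Type*} {f : Vec d → ℝ} {D : Set (Vec d)} {g : Vec d → Ξ → Vec d}
  {β βsq η lam G : ℝ} {xinit : Vec d} {ξ : ℕ → Ξ}

/-- The stochastic gradient that produces state number `k + 1` of the run. -/
def sgrad (g : Vec d → Ξ → Vec d) (β βsq η lam : ℝ) (xinit : Vec d) (ξ : ℕ → Ξ) (k : ℕ) : Vec d :=
  g (run g β βsq η lam xinit ξ k).x (ξ (k + 1))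

/-- The error of the stochastic gradient that produces state number `k + 1` of the run. -/
def noise (f : Vec d → ℝ) (g : Vec d → Ξ → Vec d) (β βsq η lam : ℝ) (xinit : Vec d) (ξ : ℕ → Ξ)
    (k : ℕ) : Vec d :=
  sgrad g β βsq η lam xinit ξ k - gradient f (run g β βsq η lam xinit ξ k).x

lemma run_m (hβ : 0 < β) (hβ₁ : β ≤ 1) (k : ℕ) :
    (run g β βsq η lam xinit ξ k).m =
      (1 - (1 - β) ^ k) • average (weight β) (sgrad g β βsq η lam xinit ξ) k := by
  induction k with
  | zero => simp [run]
  | succ k ih =>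
    have hstep : (run g β βsq η lam xinit ξ (k + 1)).m =
        (1 - β) • (run g β βsq η lam xinit ξ k).m + β • sgrad g β βsq η lam xinit ξ k := rfl
    have hweight : (1 - (1 - β) ^ (k + 1)) * weight β k = β :=
      mul_div_cancel₀ _ (one_sub_pow_succ_pos hβ hβ₁ k).ne'
    rw [hstep, ih, average, smul_add, smul_smul, smul_smul, smul_smul, hweight,
      one_sub_pow_mul_one_sub_weight hβ hβ₁ k]

lemma run_v_mem_Icc (hβsq : 0 ≤ βsq) (hβsq₁ : βsq ≤ 1) {B : ℝ} (k : ℕ)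
    (hB : ∀ j < k, ‖sgrad g β βsq η lam xinit ξ j‖ ≤ B) (i : Fin d) :
    (run g β βsq η lam xinit ξ k).v i ∈ Icc 0 ((1 - (1 - βsq) ^ k) * B ^ 2) := by
  induction k with
  | zero => simp [run]
  | succ k ih =>
    obtain ⟨hv₀, hv⟩ := ih fun j hj => hB j (hj.trans k.lt_succ_self)
    have hstep : (run g β βsq η lam xinit ξ (k + 1)).v i =
        (1 - βsq) * (run g β βsq η lam xinit ξ k).v i +
          βsq * (sgrad g β βsq η lam xinit ξ k i) ^ 2 := rfl
    have : 0 ≤ 1 - βsq := sub_nonneg.2 hβsq₁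
    have hgrad : (sgrad g β βsq η lam xinit ξ k i) ^ 2 ≤ B ^ 2 :=
      sq_le_sq' (abs_le.1 ((PiLp.norm_apply_le _ i).trans (hB k k.lt_succ_self))).1
        (abs_le.1 ((PiLp.norm_apply_le _ i).trans (hB k k.lt_succ_self))).2
    rw [hstep]
    refine ⟨by positivity, ?_⟩
    calc _ ≤ (1 - βsq) * ((1 - (1 - βsq) ^ k) * B ^ 2) + βsq * B ^ 2 := by gcongr
      _ = _ := by ring

lemma isScaledStep_run (hβ : 0 < β) (hβ₁ : β ≤ 1) (hβsq : 0 ≤ βsq) (hβsq₁ : βsq ≤ 1) (hη : 0 ≤ η)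
    (hlam : 0 < lam) {B : ℝ} (hB₀ : 0 ≤ B) (k : ℕ)
    (hB : ∀ j ≤ k, ‖sgrad g β βsq η lam xinit ξ j‖ ≤ B) :
    IsScaledStep (η / (B + lam)) (η / lam) (run g β βsq η lam xinit ξ k).x
      (average (weight β) (sgrad g β βsq η lam xinit ξ) (k + 1))
      (run g β βsq η lam xinit ξ (k + 1)).x := by
  intro i
  set s : State d := run g β βsq η lam xinit ξ (k + 1) with hs
  set vhat : ℝ := s.v i / (1 - (1 - βsq) ^ (k + 1))
  have hx : s.x i = (run g β βsq η lam xinit ξ k).x i -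
      η / (√vhat + lam) * (s.m i / (1 - (1 - β) ^ (k + 1))) := rfl
  have hm : s.m i / (1 - (1 - β) ^ (k + 1)) =
      average (weight β) (sgrad g β βsq η lam xinit ξ) (k + 1) i := by
    rw [hs, run_m hβ hβ₁, PiLp.smul_apply, smul_eq_mul,
      mul_div_cancel_left₀ _ (one_sub_pow_succ_pos hβ hβ₁ k).ne']
  have hsqrt : √vhat ≤ B := by
    have hv := (run_v_mem_Icc (β := β) (η := η) (lam := lam) hβsq hβsq₁ (k + 1)
      (fun j hj => hB j (Nat.lt_succ_iff.1 hj)) i).2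
    have hcorrection : 0 ≤ 1 - (1 - βsq) ^ (k + 1) :=
      sub_nonneg.2 (pow_le_one₀ (by linarith) (by linarith))
    exact Real.sqrt_le_iff.2
      ⟨hB₀, div_le_of_le_mul₀ hcorrection (sq_nonneg B) (by linarith)⟩
  refine ⟨η / (√vhat + lam), ⟨by gcongr, ?_⟩, by rw [hx, hm]⟩
  gcongr
  exact le_add_of_nonneg_left (Real.sqrt_nonneg _)

lemma isMomentumDescent_run (hβ : 0 < β) (hβ₁ : β ≤ 1) (hβsq : 0 ≤ βsq) (hβsq₁ : βsq ≤ 1)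
    (hη : 0 ≤ η) (hlam : 0 < lam) (hlamG : 2 * lam ≤ G)
    (hnoise : ∀ k, ‖noise f g β βsq η lam xinit ξ k‖ ≤ G / 2)
    (hseg : ∀ k, segment ℝ (run g β βsq η lam xinit ξ k).x
      (run g β βsq η lam xinit ξ (k + 1)).x ⊆ D) :
    IsMomentumDescent f D (weight β) (η / (2 * G)) (η / lam) G
      (fun k => (run g β βsq η lam xinit ξ k).x) (noise f g β βsq η lam xinit ξ) where
  segment_subset := hseg
  norm_noise_le := hnoise
  step k hk := by
    have hsgrad : (fun j => gradient f (run g β βsq η lam xinit ξ j).x) +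
        noise f g β βsq η lam xinit ξ = sgrad g β βsq η lam xinit ξ := by
      funext j; simp [noise]
    have hbound : ∀ j ≤ k, ‖sgrad g β βsq η lam xinit ξ j‖ ≤ G + G / 2 := fun j hj => by
      rw [← hsgrad]
      exact norm_add_le_of_le (hk j hj) (hnoise j)
    have hlo : η / (2 * G) ≤ η / (G + G / 2 + lam) := by gcongr <;> linarith
    rw [hsgrad]
    exact fun i => (isScaledStep_run hβ hβ₁ hβsq hβsq₁ hη hlam (by linarith) k hbound i).imp
      fun h hh => ⟨Icc_subset_Icc_left hlo hh.1, hh.2⟩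

lemma sum_Icc_iterate (g : Vec d → Ξ → Vec d) (β βsq η lam : ℝ) (xinit : Vec d) (ξ : ℕ → Ξ)
    (φ : Vec d → ℝ) (T : ℕ) :
    ∑ t ∈ Finset.Icc 1 T, φ (iterate g β βsq η lam xinit ξ t) =
      ∑ k ∈ Finset.range T, φ (run g β βsq η lam xinit ξ k).x := by
  rw [Finset.range_eq_Ico, ← Finset.sum_Ico_add_right_sub_eq 0 T 1]
  rfl

end Run

section Measurability

variable {d : ℕ} {Ω Ξ : Type*} [MeasurableSpace Ξ] {f : Vec d → ℝ} {g : Vec d → Ξ → Vec d}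
  {β βsq η lam : ℝ} {xinit : Vec d} {ξ : ℕ → Ω → Ξ}

lemma measurable_gradient {E : Type*} [NormedAddCommGroup E] [InnerProductSpace ℝ E]
    [CompleteSpace E] [MeasurableSpace E] [BorelSpace E] (f : E → ℝ) : Measurable (gradient f) :=
  (InnerProductSpace.toDual ℝ E).symm.continuous.measurable.comp (measurable_fderiv ℝ f)

lemma measurable_step {_ : MeasurableSpace Ω} (hg : Measurable fun p : Vec d × Ξ => g p.1 p.2)
    (t : ℕ) {ζ : Ω → Ξ} {s : Ω → State d} (hζ : Measurable ζ) (hx : Measurable fun ω => (s ω).x)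
    (hm : Measurable fun ω => (s ω).m) (hv : Measurable fun ω => (s ω).v) :
    Measurable (fun ω => (step g β βsq η lam t (ζ ω) (s ω)).x) ∧
      Measurable (fun ω => (step g β βsq η lam t (ζ ω) (s ω)).m) ∧
      Measurable fun ω => (step g β βsq η lam t (ζ ω) (s ω)).v := by
  have : Measurable fun ω => g (s ω).x (ζ ω) := hg.comp (hx.prodMk hζ)
  simp only [step]
  exact ⟨by fun_prop, by fun_prop, by fun_prop⟩

lemma measurable_run {_ : MeasurableSpace Ω} (hg : Measurable fun p : Vec d × Ξ => g p.1 p.2)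
    (k : ℕ) (hξ : ∀ s, 1 ≤ s → s ≤ k → Measurable (ξ s)) :
    Measurable (fun ω => (run g β βsq η lam xinit (fun s => ξ s ω) k).x) ∧
      Measurable (fun ω => (run g β βsq η lam xinit (fun s => ξ s ω) k).m) ∧
      Measurable fun ω => (run g β βsq η lam xinit (fun s => ξ s ω) k).v := by
  induction k with
  | zero => exact ⟨measurable_const, measurable_const, measurable_const⟩
  | succ k ih =>
    obtain ⟨hx, hm, hv⟩ := ih fun s hs hsk => hξ s hs (hsk.trans k.le_succ)
    exact measurable_step hg (k + 1) (hξ (k + 1) k.succ_pos le_rfl) hx hm hv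

lemma measurable_noise {_ : MeasurableSpace Ω} (hg : Measurable fun p : Vec d × Ξ => g p.1 p.2)
    (k : ℕ) (hξ : ∀ s, 1 ≤ s → s ≤ k + 1 → Measurable (ξ s)) :
    Measurable fun ω => noise f g β βsq η lam xinit (fun s => ξ s ω) k := by
  have hx := (measurable_run (β := β) (βsq := βsq) (η := η) (lam := lam) (xinit := xinit) hg k
    fun s hs hsk => hξ s hs (hsk.trans k.le_succ)).1
  exact (hg.comp (hx.prodMk (hξ (k + 1) k.succ_pos le_rfl))).sub
    ((measurable_gradient f).comp hx)

lemma measurable_past {s t : ℕ} (hs : 1 ≤ s) (hst : s < t) : Measurable[past ξ t] (ξ s) :=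
  measurable_iff_comap_le.2 (le_iSup₂_of_le (f := fun s (_ : s ∈ {s : ℕ | 1 ≤ s ∧ s < t}) =>
    MeasurableSpace.comap (ξ s) inferInstance) s ⟨hs, hst⟩ le_rfl)

lemma past_mono : Monotone (past ξ) := fun _ _ hst =>
  biSup_mono fun _ hs => ⟨hs.1, hs.2.trans_le hst⟩

/-- The filtration whose member number `k` is generated by the samples `ξ 1, …, ξ k`, which
determine state number `k` of the run. -/
def sampleFiltration {m₀ : MeasurableSpace Ω} (hξ : ∀ t, Measurable (ξ t)) : Filtration ℕ m₀ where
  seq k := past ξ (k + 1)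
  mono' _ _ h := past_mono (Nat.succ_le_succ h)
  le' _ := iSup₂_le fun s _ => (hξ s).comap_le

end Measurability

section Noise

variable {d : ℕ} {Ω Ξ : Type*} [MeasurableSpace Ω] [MeasurableSpace Ξ] {μ : Measure Ω}
  {f : Vec d → ℝ} {g : Vec d → Ξ → Vec d} {β βsq η lam σ : ℝ} {xinit : Vec d} {ξ : ℕ → Ω → Ξ}

lemma BoundedNoise.isBoundedMartingaleDiff [IsFiniteMeasure μ]
    (hN : BoundedNoise μ f g ξ (fun t ω => iterate g β βsq η lam xinit (fun s => ξ s ω) t) σ)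
    (hg : Measurable fun p : Vec d × Ξ => g p.1 p.2) (hξ : ∀ t, Measurable (ξ t)) :
    IsBoundedMartingaleDiff μ (sampleFiltration hξ)
      (fun k ω => noise f g β βsq η lam xinit (fun s => ξ s ω) k) fun _ => σ := by
  have hbound (k : ℕ) : ∀ᵐ ω ∂μ, ‖noise f g β βsq η lam xinit (fun s => ξ s ω) k‖ ≤ σ :=
    hN.bounded (k + 1) k.succ_pos
  have hmeas (k : ℕ) : StronglyMeasurable[sampleFiltration hξ (k + 1)]
      fun ω => noise f g β βsq η lam xinit (fun s => ξ s ω) k :=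
    (measurable_noise hg k fun s hs hsk =>
      measurable_past hs (Nat.lt_succ_of_le hsk)).stronglyMeasurable
  refine ⟨hmeas, fun k => ?_, hbound⟩
  set 𝒢 := sampleFiltration hξ
  have hunbiased : μ[fun ω => sgrad g β βsq η lam xinit (fun s => ξ s ω) k | 𝒢 k] =ᵐ[μ]
      fun ω => gradient f (run g β βsq η lam xinit (fun s => ξ s ω) k).x :=
    hN.unbiased (k + 1) k.succ_pos
  have hgrad : Integrable
      (fun ω => gradient f (run g β βsq η lam xinit (fun s => ξ s ω) k).x) μ :=
    integrable_condExp.congr hunbiased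
  have hsgrad : Integrable (fun ω => sgrad g β βsq η lam xinit (fun s => ξ s ω) k) μ := by
    refine (Integrable.add (.of_bound ((hmeas k).mono (𝒢.le _)).aestronglyMeasurable σ (hbound k))
      hgrad).congr (ae_of_all _ fun ω => ?_)
    simp [noise]
  have hgrad_meas : StronglyMeasurable[𝒢 k]
      fun ω => gradient f (run g β βsq η lam xinit (fun s => ξ s ω) k).x :=
    ((measurable_gradient f).comp (measurable_run hg k fun s hs hsk =>
      measurable_past hs (Nat.lt_succ_of_le hsk)).1).stronglyMeasurable
  filter_upwards [condExp_sub hsgrad hgrad (𝒢 k), hunbiased] with ω hsub hω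
  rw [condExp_of_stronglyMeasurable (𝒢.le _) hgrad_meas hgrad] at hsub
  exact hsub.trans (sub_eq_zero.2 hω)

end Noise

lemma ofReal_one_sub_le_measure {Ω : Type*} [MeasurableSpace Ω] {μ : Measure Ω}
    [IsProbabilityMeasure μ] {bad good : Set Ω} {δ : ℝ} (hδ : 0 ≤ δ)
    (hbad : μ bad ≤ ENNReal.ofReal δ) (hgood : ∀ᵐ ω ∂μ, ω ∉ bad → ω ∈ good) :
    ENNReal.ofReal (1 - δ) ≤ μ good := by
  rw [ENNReal.ofReal_sub _ hδ, ENNReal.ofReal_one, tsub_le_iff_left]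
  have hcover : ∀ᵐ ω ∂μ, ω ∈ (univ : Set Ω) → ω ∈ bad ∪ good :=
    hgood.mono fun ω hω _ => or_iff_not_imp_left.2 hω
  calc 1 = μ univ := measure_univ.symm
    _ ≤ μ (bad ∪ good) := measure_mono_ae hcover
    _ ≤ μ bad + μ good := measure_union_le _ _
    _ ≤ ENNReal.ofReal δ + μ good := by gcongr

/-! ### Parameters -/

section Parameters

variable {c₁ c₂ δ ε σ lam L₀ Lρ ρ G β η C₂ Δ₁ : ℝ}

namespace Admissible

lemma β_le_one (h : Admissible c₁ c₂ δ ε σ lam L₀ Lρ ρ G β η) : β ≤ 1 :=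
  ENNReal.ofReal_le_one.1 (h.β_le.trans (min_le_left _ _))

lemma β_mul_le (h : Admissible c₁ c₂ δ ε σ lam L₀ Lρ ρ G β η) (hc₁ : 0 ≤ c₁) (hlam : 0 ≤ lam) :
    β * (σ ^ 2 * G * √(Real.log (1 / δ))) ≤ c₁ * lam * ε ^ 2 := by
  have hle := ENNReal.mul_le_of_le_div (h.β_le.trans (min_le_right _ _))
  rw [← ENNReal.ofReal_mul h.β_pos.le] at hle
  exact (ENNReal.ofReal_le_ofReal_iff (by positivity)).1 hle

lemma η_mul_le (h : Admissible c₁ c₂ δ ε σ lam L₀ Lρ ρ G β η) (hc₂ : 0 ≤ c₂) :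
    η * (G * effSmooth L₀ Lρ ρ G * √(Real.log (1 / δ))) ≤ c₂ * (lam ^ 2 * β) := by
  have hdiv := h.η_le.trans (mul_le_mul_right (min_le_right _ _) _)
  rw [← mul_div_assoc, ← ENNReal.ofReal_mul hc₂] at hdiv
  have hle := ENNReal.mul_le_of_le_div hdiv
  rw [← ENNReal.ofReal_mul h.η_pos.le] at hle
  have hβ := h.β_pos.le
  exact (ENNReal.ofReal_le_ofReal_iff (by positivity)).1 hle

lemma ofReal_step_le_radius (h : Admissible c₁ c₂ δ ε σ lam L₀ Lρ ρ G β η) (hc₂ : 0 ≤ c₂)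
    (hc₂' : c₂ ≤ 1 / 2) (hlam : 0 < lam) (hG : 0 < G) :
    ENNReal.ofReal (η / lam * (3 / 2 * G)) ≤ radius L₀ Lρ ρ G := by
  have hη := h.η_pos.le
  calc ENNReal.ofReal (η / lam * (3 / 2 * G))
      = ENNReal.ofReal η * ENNReal.ofReal (3 / 2 * G / lam) := by
        rw [← ENNReal.ofReal_mul hη]; congr 1; ring
    _ ≤ ENNReal.ofReal c₂ * (radius L₀ Lρ ρ G * ENNReal.ofReal lam / ENNReal.ofReal G) *
        ENNReal.ofReal (3 / 2 * G / lam) := by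
        gcongr
        exact h.η_le.trans (mul_le_mul_right (min_le_left _ _) _)
    _ = radius L₀ Lρ ρ G * (ENNReal.ofReal c₂ * ENNReal.ofReal lam * ENNReal.ofReal G⁻¹ *
        ENNReal.ofReal (3 / 2 * G / lam)) := by
        rw [div_eq_mul_inv, ENNReal.ofReal_inv_of_pos hG]; ring
    _ = radius L₀ Lρ ρ G * ENNReal.ofReal (3 / 2 * c₂) := by
        rw [← ENNReal.ofReal_mul hc₂, ← ENNReal.ofReal_mul (by positivity),
          ← ENNReal.ofReal_mul (by positivity)]
        congr 2; field_simp
    _ ≤ radius L₀ Lρ ρ G * 1 := by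
        gcongr
        exact ENNReal.ofReal_le_one.2 (by linarith)
    _ = radius L₀ Lρ ρ G := mul_one _

/-- The bounds on `β` and `η` are linear in `ε ^ 2` up to the truncations, so admissibility scales
down from `ε = 1`. -/
lemma mul_sq (h : Admissible c₁ c₂ δ 1 σ lam L₀ Lρ ρ G β η) (hε : 0 < ε) (hε₁ : ε ≤ 1)
    (hc₁ : 0 ≤ c₁) (hlam : 0 ≤ lam) :
    Admissible c₁ c₂ δ ε σ lam L₀ Lρ ρ G (β * ε ^ 2) (η * ε ^ 2) := by
  have hβ := h.β_pos
  have hη := h.η_pos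
  have hscale : ENNReal.ofReal (ε ^ 2) ≤ 1 := ENNReal.ofReal_le_one.2 (pow_le_one₀ hε.le hε₁)
  refine ⟨by positivity, by positivity, ?_, ?_⟩
  · rw [ENNReal.ofReal_mul hβ.le]
    refine le_min (mul_le_one' (h.β_le.trans (min_le_left _ _)) hscale) ?_
    rw [ENNReal.ofReal_mul (p := c₁ * lam) (by positivity), ENNReal.mul_div_right_comm]
    gcongr
    simpa using h.β_le.trans (min_le_right _ _)
  · rw [ENNReal.ofReal_mul hη.le]
    refine (mul_le_mul_left h.η_le _).trans ?_
    rw [mul_assoc, min_mul_of_nonneg _ _ zero_le]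
    gcongr
    · exact mul_le_of_le_one_right zero_le hscale
    · rw [← mul_assoc, ENNReal.ofReal_mul (p := lam ^ 2 * β) (by positivity),
        ENNReal.mul_div_right_comm]

end Admissible

lemma exists_pos_ofReal_le {a : ℝ≥0∞} (ha : a ≠ 0) : ∃ r : ℝ, 0 < r ∧ ENNReal.ofReal r ≤ a := by
  obtain ⟨r, hr, hra⟩ := ENNReal.lt_iff_exists_nnreal_btwn.1 (pos_iff_ne_zero.2 ha)
  exact ⟨r, by exact_mod_cast hr, by simpa using hra.le⟩

lemma radius_ne_zero (hG : 0 < G) (hL₀ : 0 ≤ L₀) (hρ : 0 ≤ ρ) : radius L₀ Lρ ρ G ≠ 0 := by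
  refine (lt_min (ENNReal.div_pos one_ne_zero ?_) ?_).ne'
  · rw [ENNReal.ofReal_rpow_of_pos hG]
    exact ENNReal.mul_ne_top (ENNReal.mul_ne_top ENNReal.ofNat_ne_top ENNReal.ofReal_ne_top)
      ENNReal.ofReal_ne_top
  · split_ifs with h
    · exact ENNReal.coe_lt_top
    · have hL₀' : 0 < L₀ := lt_of_le_of_ne hL₀ (Ne.symm (not_or.1 h).2)
      rw [ENNReal.ofReal_rpow_of_pos hL₀']
      exact ENNReal.div_pos one_ne_zero (ENNReal.mul_ne_top ENNReal.ofNat_ne_top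
        (ENNReal.rpow_ne_top_of_nonneg (by positivity)
          (ENNReal.mul_ne_top ENNReal.ofReal_ne_top ENNReal.ofReal_ne_top)))

lemma exists_admissible (hc₁ : 0 < c₁) (hc₂ : 0 < c₂) (hε : 0 < ε) (hL₀ : 0 ≤ L₀) (hρ : 0 ≤ ρ)
    (hlam : 0 < lam) (hG : 0 < G) : ∃ β η, Admissible c₁ c₂ δ ε σ lam L₀ Lρ ρ G β η := by
  have hpos {a : ℝ} (ha : 0 < a) (b : ℝ) : 0 < ENNReal.ofReal a / ENNReal.ofReal b :=
    ENNReal.div_pos (ENNReal.ofReal_pos.2 ha).ne' ENNReal.ofReal_ne_top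
  obtain ⟨β, hβ, hβle⟩ := exists_pos_ofReal_le
    (lt_min one_pos (hpos (a := c₁ * lam * ε ^ 2) (by positivity) _)).ne'
  obtain ⟨η, hη, hηle⟩ := exists_pos_ofReal_le (mul_ne_zero (ENNReal.ofReal_pos.2 hc₂).ne'
    (lt_min (ENNReal.div_pos (mul_ne_zero (radius_ne_zero hG hL₀ hρ)
      (ENNReal.ofReal_pos.2 hlam).ne') ENNReal.ofReal_ne_top)
      (hpos (a := lam ^ 2 * β) (by positivity) _)).ne')
  exact ⟨β, η, hβ, hη, hβle, hηle⟩

lemma one_div_sq_le_horizon (C₂ Δ₁ G ε β η : ℝ) : 1 / β ^ 2 ≤ horizon C₂ Δ₁ G ε β η :=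
  (le_max_left _ _).trans (Nat.le_ceil _)

lemma div_le_horizon (C₂ Δ₁ G ε β η : ℝ) :
    C₂ * Δ₁ * G / (η * ε ^ 2) ≤ horizon C₂ Δ₁ G ε β η :=
  (le_max_right _ _).trans (Nat.le_ceil _)

lemma horizon_le (hβ : 0 < β) (hβ₁ : β ≤ 1) (hgap : 0 ≤ C₂ * Δ₁ * G / (η * ε ^ 2)) :
    (horizon C₂ Δ₁ G ε β η : ℝ) ≤ 2 / β ^ 2 + 2 * (C₂ * Δ₁ * G / (η * ε ^ 2)) := by
  have hone : 1 ≤ 1 / β ^ 2 := (one_le_div (by positivity)).2 (pow_le_one₀ hβ.le hβ₁)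
  calc (horizon C₂ Δ₁ G ε β η : ℝ) ≤ 2 * max (1 / β ^ 2) (C₂ * Δ₁ * G / (η * ε ^ 2)) :=
        Nat.ceil_le_two_mul (by linarith [le_max_left (1 / β ^ 2) (C₂ * Δ₁ * G / (η * ε ^ 2))])
    _ ≤ 2 * (1 / β ^ 2 + C₂ * Δ₁ * G / (η * ε ^ 2)) := by
        gcongr
        exact max_le_add_of_nonneg (by positivity) hgap
    _ = 2 / β ^ 2 + 2 * (C₂ * Δ₁ * G / (η * ε ^ 2)) := by ring

theorem exists_forall_exists_admissible_horizon_le (hc₁ : 0 < c₁) (hc₂ : 0 < c₂) (hC₂ : 0 ≤ C₂)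
    (hL₀ : 0 ≤ L₀) (hρ : 0 ≤ ρ) (hlam : 0 < lam) (hG : 0 < G) (hΔ₁ : 0 ≤ Δ₁) :
    ∃ K : ℝ, 0 < K ∧ ∀ ε : ℝ, 0 < ε → ε ≤ 1 → ∃ β η : ℝ,
      Admissible c₁ c₂ δ ε σ lam L₀ Lρ ρ G β η ∧ (horizon C₂ Δ₁ G ε β η : ℝ) ≤ K / ε ^ 4 := by
  obtain ⟨β, η, h⟩ : ∃ β η, Admissible c₁ c₂ δ 1 σ lam L₀ Lρ ρ G β η :=
    exists_admissible hc₁ hc₂ one_pos hL₀ hρ hlam hG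
  have hβ := h.β_pos
  have hη := h.η_pos
  refine ⟨2 / β ^ 2 + 2 * (C₂ * Δ₁ * G / η), by positivity, fun ε hε hε₁ => ?_⟩
  have hadm := h.mul_sq hε hε₁ hc₁.le hlam.le
  refine ⟨β * ε ^ 2, η * ε ^ 2, hadm, ?_⟩
  refine (horizon_le hadm.β_pos hadm.β_le_one (by positivity)).trans_eq ?_
  field_simp

end Parameters

/-! ### Convergence -/

section Constants

variable {c₁ c₂ δ δ₀ ε σ lam L₀ Lρ ρ G β η C C₁ C₂ Δ L w T U : ℝ}

/-- The factor, depending on `δ₀` only, by which the accumulated noise exceeds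
`√(log (1 / δ)) * σ ^ 2 * β * T`, uniformly in `δ ≤ δ₀`. -/
def noiseConst (δ₀ : ℝ) : ℝ := 7 + 6 / √(Real.log (1 / δ₀))

lemma seven_le_noiseConst (δ₀ : ℝ) : 7 ≤ noiseConst δ₀ := le_add_of_nonneg_right (by positivity)

lemma noiseConst_pos (δ₀ : ℝ) : 0 < noiseConst δ₀ :=
  lt_of_lt_of_le (by norm_num) (seven_le_noiseConst δ₀)

lemma sqrt_log_one_div_pos (hδ : 0 < δ) (hδ₁ : δ < 1) : 0 < √(Real.log (1 / δ)) :=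
  Real.sqrt_pos.2 (Real.log_pos ((one_lt_div hδ).2 hδ₁))

lemma noise_bound_le (hδ : 0 < δ) (hδδ₀ : δ ≤ δ₀) (hδ₀ : δ₀ < 1) (hT : 1 ≤ β ^ 2 * T) :
    σ ^ 2 * (2 * β ^ 2 * T + 4 + √(8 * (2 * β ^ 2 * T + 4) * Real.log (1 / δ))) ≤
      β * (noiseConst δ₀ * √(Real.log (1 / δ)) * (σ ^ 2 * β * T)) := by
  have hw₀ := sqrt_log_one_div_pos (hδ.trans_le hδδ₀) hδ₀
  have hw₀w : √(Real.log (1 / δ₀)) ≤ √(Real.log (1 / δ)) :=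
    Real.sqrt_le_sqrt (Real.log_le_log (one_div_pos.2 (hδ.trans_le hδδ₀)) (by gcongr))
  have hι : √(Real.log (1 / δ)) ^ 2 = Real.log (1 / δ) :=
    Real.sq_sqrt (Real.log_nonneg ((one_le_div hδ).2 (hδδ₀.trans hδ₀.le)))
  rw [noiseConst]
  set w₀ := √(Real.log (1 / δ₀))
  set w := √(Real.log (1 / δ))
  set A := 2 * β ^ 2 * T + 4
  rw [← hι]
  have hw : 0 < w := hw₀.trans_le hw₀w
  have hA_le : A ≤ 6 * (β ^ 2 * T) := by linarith
  have hsqrt : √(8 * A * w ^ 2) ≤ 7 * (β ^ 2 * T) * w := by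
    refine Real.sqrt_le_iff.2 ⟨by positivity, ?_⟩
    have hA_sq : 8 * A ≤ 49 * (β ^ 2 * T) ^ 2 := by nlinarith
    calc 8 * A * w ^ 2 ≤ 49 * (β ^ 2 * T) ^ 2 * w ^ 2 :=
          mul_le_mul_of_nonneg_right hA_sq (sq_nonneg w)
      _ = (7 * (β ^ 2 * T) * w) ^ 2 := by ring
  have hratio : 1 ≤ w / w₀ := (one_le_div hw₀).2 hw₀w
  calc σ ^ 2 * (A + √(8 * A * w ^ 2))
      ≤ σ ^ 2 * (6 * (β ^ 2 * T) * (w / w₀) + 7 * (β ^ 2 * T) * w) := by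
        gcongr
        exact hA_le.trans (le_mul_of_one_le_right (by positivity) hratio)
    _ = β * ((7 + 6 / w₀) * w * (σ ^ 2 * β * T)) := by field_simp; ring

lemma mul_effSmooth_mul_le (hlam : 0 < lam) (hG : 0 < G) (hC₁ : 0 ≤ C₁) (hΔ : 0 ≤ Δ) (hLρ : 0 ≤ Lρ)
    (hρ₁ : ρ < 1) (hGL₀ : C₁ * Δ * L₀ / lam ≤ G)
    (hGLρ : (C₁ * Δ * Lρ / lam) ^ (1 / (1 - ρ)) ≤ G) :
    C₁ * (effSmooth L₀ Lρ ρ G * Δ) ≤ 7 * (lam * G) := by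
  have hρ' : 0 < 1 - ρ := sub_pos.2 hρ₁
  have hroot : C₁ * Δ * Lρ / lam ≤ G ^ (1 - ρ) := by
    rwa [one_div, Real.rpow_inv_le_iff_of_pos (by positivity) hG.le hρ'] at hGLρ
  rw [div_le_iff₀ hlam] at hGL₀ hroot
  have hpower : C₁ * Δ * Lρ * G ^ ρ ≤ G * lam := by
    calc C₁ * Δ * Lρ * G ^ ρ ≤ G ^ (1 - ρ) * lam * G ^ ρ := by gcongr
      _ = G ^ (1 - ρ) * G ^ ρ * lam := by ring
      _ = G * lam := by rw [← Real.rpow_add hG, sub_add_cancel, Real.rpow_one]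
  rw [effSmooth]
  linarith

lemma lag_le (hlam : 0 < lam) (hlamG : 2 * lam ≤ G) (hη : 0 ≤ η) (hL : 0 ≤ L) (hw : 0 < w)
    (hc₂ : 10 * c₂ ≤ w) (hβ : 0 ≤ β) (hηle : η * (G * L * w) ≤ c₂ * (lam ^ 2 * β)) :
    96 * (L * (η / lam)) ^ 2 * (η / lam) ≤ η / (2 * G) * β ^ 2 := by
  have hG : 0 < G := by linarith
  have hLη : L * (η / lam) ≤ lam * β / (10 * G) := by
    rw [mul_div_assoc', div_le_div_iff₀ hlam (by positivity)]
    refine le_of_mul_le_mul_right ?_ hw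
    calc L * η * (10 * G) * w = 10 * (η * (G * L * w)) := by ring
      _ ≤ 10 * (c₂ * (lam ^ 2 * β)) := by gcongr
      _ = 10 * c₂ * (lam ^ 2 * β) := by ring
      _ ≤ w * (lam ^ 2 * β) := by gcongr
      _ = lam * β * lam * w := by ring
  calc 96 * (L * (η / lam)) ^ 2 * (η / lam) ≤ 96 * (lam * β / (10 * G)) ^ 2 * (η / lam) := by
        gcongr
    _ = 96 / 200 * (2 * lam) * (η / (2 * G) * β ^ 2) / G * 2 := by field_simp; ring
    _ ≤ 96 / 200 * G * (η / (2 * G) * β ^ 2) / G * 2 := by gcongr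
    _ = 96 / 100 * (η / (2 * G) * β ^ 2) := by field_simp; ring
    _ ≤ η / (2 * G) * β ^ 2 := mul_le_of_le_one_left (by positivity) (by norm_num)

lemma mul_noise_le (hlam : 0 < lam) (hG : 0 < G) (hβ : 0 < β) (hη : 0 < η) (hε : 0 < ε)
    (hL : 0 ≤ L) (hΔ : 0 ≤ Δ) (hw : 0 ≤ w) (hC : 0 ≤ C) (hC₂ : 0 ≤ C₂) (hσ : 0 ≤ σ)
    (hσG : 2 * σ ≤ G) (hc₁ : 8 * C * C₂ * c₁ ≤ 1) (hc₂ : 5000 * C * c₂ ≤ 1)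
    (hβle : β * (σ ^ 2 * G * w) ≤ c₁ * lam * ε ^ 2)
    (hηle : η * (G * L * w) ≤ c₂ * (lam ^ 2 * β))
    (hT : T ≤ 2 / β ^ 2 + 2 * (C₂ * Δ * G / (η * ε ^ 2))) :
    L * (4 * (η / lam) * (C * w * (σ ^ 2 * β * T))) ≤ L * Δ + 2 / 5000 * (lam * G) := by
  have hη_part : 8 * C * σ ^ 2 / (G * lam * β) * (η * (G * L * w)) ≤ 2 / 5000 * (lam * G) := by
    calc 8 * C * σ ^ 2 / (G * lam * β) * (η * (G * L * w))
        ≤ 8 * C * σ ^ 2 / (G * lam * β) * (c₂ * (lam ^ 2 * β)) := by gcongr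
      _ = 5000 * C * c₂ * (2 / 5000 * lam * (2 * σ) ^ 2 / G) := by field_simp; ring
      _ ≤ 1 * (2 / 5000 * lam * G ^ 2 / G) := by gcongr
      _ = 2 / 5000 * (lam * G) := by field_simp
  have hβ_part : 8 * C * C₂ / (lam * ε ^ 2) * (L * Δ) * (β * (σ ^ 2 * G * w)) ≤ L * Δ := by
    calc 8 * C * C₂ / (lam * ε ^ 2) * (L * Δ) * (β * (σ ^ 2 * G * w))
        ≤ 8 * C * C₂ / (lam * ε ^ 2) * (L * Δ) * (c₁ * lam * ε ^ 2) := by gcongr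
      _ = 8 * C * C₂ * c₁ * (L * Δ) := by field_simp
      _ ≤ L * Δ := mul_le_of_le_one_left (by positivity) hc₁
  calc L * (4 * (η / lam) * (C * w * (σ ^ 2 * β * T)))
      ≤ L * (4 * (η / lam) * (C * w * (σ ^ 2 * β *
          (2 / β ^ 2 + 2 * (C₂ * Δ * G / (η * ε ^ 2)))))) := by gcongr
    _ = 8 * C * C₂ / (lam * ε ^ 2) * (L * Δ) * (β * (σ ^ 2 * G * w)) +
          8 * C * σ ^ 2 / (G * lam * β) * (η * (G * L * w)) := by field_simp; ring
    _ ≤ L * Δ + 2 / 5000 * (lam * G) := add_le_add hβ_part hη_part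

lemma budget_le (hlam : 0 < lam) (hG : 0 < G) (hη : 0 ≤ η) (hL : 0 ≤ L) (hΔ : 0 ≤ Δ)
    (hC₁ : 20000 ≤ C₁) (hLΔ : C₁ * (L * Δ) ≤ 7 * (lam * G))
    (hU : L * U ≤ L * Δ + 2 / 5000 * (lam * G)) :
    384 * (L * (η / lam)) * (Δ + U) ≤ η / (2 * G) * G ^ 2 := by
  have hLΔ' : 20000 * (L * Δ) ≤ C₁ * (L * Δ) := by gcongr
  calc 384 * (L * (η / lam)) * (Δ + U) = 384 * (η / lam) * (L * Δ + L * U) := by ring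
    _ ≤ 384 * (η / lam) * (lam * G / 768) := by gcongr; linarith [mul_pos hlam hG]
    _ = η / (2 * G) * G ^ 2 := by field_simp; ring

lemma mean_le_of_descent (hlam : 0 < lam) (hG : 0 < G) (hη : 0 < η) (hC : 0 ≤ C) (hΔ : 0 ≤ Δ)
    (hε : 0 < ε) (hC₂ : 32 ≤ C₂) (hc₁ : 128 * C * c₁ ≤ 1) (hT₀ : 0 < T)
    (hβle : β * (σ ^ 2 * G * w) ≤ c₁ * lam * ε ^ 2) (hT : C₂ * Δ * G / (η * ε ^ 2) ≤ T)
    (hU : η / (2 * G) / 8 * U ≤ Δ + 4 * (η / lam) * (C * w * (σ ^ 2 * β * T))) :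
    1 / T * U ≤ ε ^ 2 := by
  have hgap : 16 * G * Δ / η ≤ T * ε ^ 2 / 2 := by
    have : 32 * (Δ * G) ≤ C₂ * (Δ * G) := by gcongr
    rw [div_le_iff₀ (by positivity)] at hT
    rw [div_le_iff₀ hη]
    linarith
  have hnoise : 64 * C * T / lam * (β * (σ ^ 2 * G * w)) ≤ T * ε ^ 2 / 2 := by
    calc 64 * C * T / lam * (β * (σ ^ 2 * G * w)) ≤ 64 * C * T / lam * (c₁ * lam * ε ^ 2) := by
          gcongr
      _ = 128 * C * c₁ * (T * ε ^ 2 / 2) := by field_simp; ring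
      _ ≤ T * ε ^ 2 / 2 := mul_le_of_le_one_left (by positivity) hc₁
  rw [one_div, inv_mul_le_iff₀ hT₀]
  calc U = 16 * G / η * (η / (2 * G) / 8 * U) := by field_simp; ring
    _ ≤ 16 * G / η * (Δ + 4 * (η / lam) * (C * w * (σ ^ 2 * β * T))) := by gcongr
    _ = 16 * G * Δ / η + 64 * C * T / lam * (β * (σ ^ 2 * G * w)) := by field_simp; ring
    _ ≤ T * ε ^ 2 := by linarith

end Constants

section Convergence

variable {d : ℕ} {Ω Ξ : Type*} {f : Vec d → ℝ} {D : Set (Vec d)} {g : Vec d → Ξ → Vec d}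
  {xinit : Vec d} {δ₀ C₁ C₂ c₁ c₂ δ ε σ lam L₀ Lρ ρ G β βsq η : ℝ}

lemma sub_gap_le (hf : BddBelow (f '' D)) {x : Vec d} (hx : x ∈ D) :
    f xinit - gap f D xinit ≤ f x :=
  (sub_sub_cancel _ _).trans_le (csInf_le hf (mem_image_of_mem f hx))

lemma mul_noiseConst_mul_le_one (hC₂ : 20000 ≤ C₂) {c : ℝ} (hc : 0 ≤ c)
    (h : 8 * noiseConst δ₀ * C₂ * c ≤ 1) {K : ℝ} (hK : K ≤ 160000) :
    K * noiseConst δ₀ * c ≤ 1 := by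
  have hnoise := noiseConst_pos δ₀
  refine le_trans ?_ h
  calc K * noiseConst δ₀ * c ≤ 160000 * noiseConst δ₀ * c := by gcongr
    _ = 8 * noiseConst δ₀ * 20000 * c := by ring
    _ ≤ 8 * noiseConst δ₀ * C₂ * c := by gcongr

/-- What "`C₁, C₂` large enough depending on `δ₀`, and then `c₁, c₂` small enough" amounts to. -/
structure IsConstantChoice (δ₀ C₁ C₂ c₁ c₂ : ℝ) : Prop where
  δ₀_lt_one : δ₀ < 1
  le_C₁ : 20000 ≤ C₁
  le_C₂ : 20000 ≤ C₂
  c₁_pos : 0 < c₁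
  c₁_le : 8 * noiseConst δ₀ * C₂ * c₁ ≤ 1
  c₂_pos : 0 < c₂
  c₂_le : 8 * noiseConst δ₀ * C₂ * c₂ ≤ 1

namespace IsConstantChoice

lemma C₁_pos (hc : IsConstantChoice δ₀ C₁ C₂ c₁ c₂) : 0 < C₁ := by linarith [hc.le_C₁]

lemma C₂_pos (hc : IsConstantChoice δ₀ C₁ C₂ c₁ c₂) : 0 < C₂ := by linarith [hc.le_C₂]

lemma c₂_le_half (hc : IsConstantChoice δ₀ C₁ C₂ c₁ c₂) : c₂ ≤ 1 / 2 := by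
  have h := mul_noiseConst_mul_le_one hc.le_C₂ hc.c₂_pos.le hc.c₂_le (K := 1) (by norm_num)
  nlinarith [seven_le_noiseConst δ₀, hc.c₂_pos]

lemma ten_mul_c₂_le (hc : IsConstantChoice δ₀ C₁ C₂ c₁ c₂) (hδ : 0 < δ) (hδδ₀ : δ ≤ δ₀) :
    10 * c₂ ≤ √(Real.log (1 / δ)) := by
  have hδ₀ := hδ.trans_le hδδ₀
  have hw₀ := sqrt_log_one_div_pos hδ₀ hc.δ₀_lt_one
  have hc₂ := hc.c₂_pos
  have h := mul_noiseConst_mul_le_one hc.le_C₂ hc₂.le hc.c₂_le (K := 10 / 6) (by norm_num)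
  calc 10 * c₂ = 10 / 6 * (6 / √(Real.log (1 / δ₀))) * c₂ * √(Real.log (1 / δ₀)) := by
        field_simp
    _ ≤ 10 / 6 * noiseConst δ₀ * c₂ * √(Real.log (1 / δ₀)) := by
        gcongr
        exact le_add_of_nonneg_left (by norm_num)
    _ ≤ 1 * √(Real.log (1 / δ)) := by gcongr
    _ = √(Real.log (1 / δ)) := one_mul _

end IsConstantChoice

/-- The assumptions of the convergence theorem that do not involve the samples: those on the
objective, on its initial point and on the parameters. -/
structure IsTuned (f : Vec d → ℝ) (D : Set (Vec d)) (xinit : Vec d)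
    (C₁ c₁ c₂ L₀ Lρ ρ σ lam δ ε G β βsq η : ℝ) : Prop where
  L₀_nonneg : 0 ≤ L₀
  Lρ_nonneg : 0 ≤ Lρ
  ρ_nonneg : 0 ≤ ρ
  ρ_lt_one : ρ < 1
  σ_nonneg : 0 ≤ σ
  lam_pos : 0 < lam
  δ_pos : 0 < δ
  ε_pos : 0 < ε
  isOpen : IsOpen D
  mem : xinit ∈ D
  bddBelow : BddBelow (f '' D)
  smooth : IsL0LrhoSmoothOn f D L₀ Lρ ρ
  two_mul_lam_le : 2 * lam ≤ G
  two_mul_σ_le : 2 * σ ≤ G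
  two_mul_gradient_le : 2 * ‖gradient f xinit‖ ≤ G
  gap_L₀_le : C₁ * gap f D xinit * L₀ / lam ≤ G
  gap_Lρ_le : (C₁ * gap f D xinit * Lρ / lam) ^ (1 / (1 - ρ)) ≤ G
  βsq_nonneg : 0 ≤ βsq
  βsq_le_one : βsq ≤ 1
  admissible : Admissible c₁ c₂ δ ε σ lam L₀ Lρ ρ G β η

namespace IsTuned

lemma G_pos (h : IsTuned f D xinit C₁ c₁ c₂ L₀ Lρ ρ σ lam δ ε G β βsq η) : 0 < G :=
  (mul_pos two_pos h.lam_pos).trans_le h.two_mul_lam_le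

lemma effSmooth_nonneg (h : IsTuned f D xinit C₁ c₁ c₂ L₀ Lρ ρ σ lam δ ε G β βsq η) :
    0 ≤ effSmooth L₀ Lρ ρ G :=
  AdamConv.effSmooth_nonneg h.L₀_nonneg h.Lρ_nonneg h.G_pos.le

lemma gap_nonneg (h : IsTuned f D xinit C₁ c₁ c₂ L₀ Lρ ρ σ lam δ ε G β βsq η) :
    0 ≤ gap f D xinit :=
  sub_nonneg.2 (csInf_le h.bddBelow (mem_image_of_mem f h.mem))

lemma sqrt_log_pos (h : IsTuned f D xinit C₁ c₁ c₂ L₀ Lρ ρ σ lam δ ε G β βsq η)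
    (hc : IsConstantChoice δ₀ C₁ C₂ c₁ c₂) (hδδ₀ : δ ≤ δ₀) : 0 < √(Real.log (1 / δ)) :=
  sqrt_log_one_div_pos h.δ_pos (hδδ₀.trans_lt hc.δ₀_lt_one)

lemma lag_le (h : IsTuned f D xinit C₁ c₁ c₂ L₀ Lρ ρ σ lam δ ε G β βsq η)
    (hc : IsConstantChoice δ₀ C₁ C₂ c₁ c₂) (hδδ₀ : δ ≤ δ₀) :
    96 * (effSmooth L₀ Lρ ρ G * (η / lam)) ^ 2 * (η / lam) ≤ η / (2 * G) * β ^ 2 :=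
  AdamConv.lag_le h.lam_pos h.two_mul_lam_le h.admissible.η_pos.le h.effSmooth_nonneg
    (h.sqrt_log_pos hc hδδ₀) (hc.ten_mul_c₂_le h.δ_pos hδδ₀) h.admissible.β_pos.le
    (h.admissible.η_mul_le hc.c₂_pos.le)

lemma budget_le (h : IsTuned f D xinit C₁ c₁ c₂ L₀ Lρ ρ σ lam δ ε G β βsq η)
    (hc : IsConstantChoice δ₀ C₁ C₂ c₁ c₂) :
    384 * (effSmooth L₀ Lρ ρ G * (η / lam)) * (gap f D xinit + 4 * (η / lam) *
      (noiseConst δ₀ * √(Real.log (1 / δ)) *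
        (σ ^ 2 * β * horizon C₂ (gap f D xinit) G ε β η))) ≤ η / (2 * G) * G ^ 2 := by
  have hlam := h.lam_pos
  have hG := h.G_pos
  have hβ := h.admissible.β_pos
  have hη := h.admissible.η_pos
  have hε := h.ε_pos
  have hΔ := h.gap_nonneg
  have hC₂ := hc.C₂_pos
  have hgap := mul_effSmooth_mul_le hlam hG hc.C₁_pos.le hΔ h.Lρ_nonneg h.ρ_lt_one h.gap_L₀_le
    h.gap_Lρ_le
  have hT := horizon_le hβ h.admissible.β_le_one
    (show 0 ≤ C₂ * gap f D xinit * G / (η * ε ^ 2) by positivity)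
  have hnoise := mul_noise_le hlam hG hβ hη hε h.effSmooth_nonneg hΔ
    (Real.sqrt_nonneg (Real.log (1 / δ))) (noiseConst_pos δ₀).le hC₂.le h.σ_nonneg h.two_mul_σ_le
    hc.c₁_le (mul_noiseConst_mul_le_one hc.le_C₂ hc.c₂_pos.le hc.c₂_le (by norm_num))
    (h.admissible.β_mul_le hc.c₁_pos.le hlam.le) (h.admissible.η_mul_le hc.c₂_pos.le) hT
  exact AdamConv.budget_le hlam hG hη.le h.effSmooth_nonneg hΔ hc.le_C₁ hgap hnoise

theorem norm_gradient_le_and_mean_le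
    (h : IsTuned f D xinit C₁ c₁ c₂ L₀ Lρ ρ σ lam δ ε G β βsq η)
    (hc : IsConstantChoice δ₀ C₁ C₂ c₁ c₂) (hδδ₀ : δ ≤ δ₀) {ξ : ℕ → Ξ} {T : ℕ}
    (hT : T = horizon C₂ (gap f D xinit) G ε β η)
    (hnoise : ∀ k, ‖noise f g β βsq η lam xinit ξ k‖ ≤ σ)
    (hseg : ∀ k, segment ℝ (run g β βsq η lam xinit ξ k).x
      (run g β βsq η lam xinit ξ (k + 1)).x ⊆ D)
    (haverage : β * ∑ k ∈ Finset.range T,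
      ‖average (weight β) (noise f g β βsq η lam xinit ξ) (k + 1)‖ ^ 2 ≤
        σ ^ 2 * (2 * β ^ 2 * T + 4 + √(8 * (2 * β ^ 2 * T + 4) * Real.log (1 / δ)))) :
    (∀ k < T, ‖gradient f (run g β βsq η lam xinit ξ k).x‖ ≤ G) ∧
      1 / (T : ℝ) * ∑ k ∈ Finset.range T, ‖gradient f (run g β βsq η lam xinit ξ k).x‖ ^ 2 ≤
        ε ^ 2 := by
  have hlam := h.lam_pos
  have hG := h.G_pos
  have hβ := h.admissible.β_pos
  have hβ₁ := h.admissible.β_le_one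
  have hη := h.admissible.η_pos
  have hT_ge : 1 / β ^ 2 ≤ (T : ℝ) := hT ▸ one_div_sq_le_horizon _ _ _ _ _ _
  have hlo_le_hi : η / (2 * G) ≤ η / lam := by gcongr; linarith [h.two_mul_lam_le]
  have hdescent := isMomentumDescent_run hβ hβ₁ h.βsq_nonneg h.βsq_le_one hη.le hlam
    h.two_mul_lam_le (fun k => (hnoise k).trans (by linarith [h.two_mul_σ_le])) hseg
  have hsmooth := h.smooth.isSmoothNear h.isOpen h.L₀_nonneg h.Lρ_nonneg h.ρ_nonneg h.ρ_lt_one hG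
    (h.admissible.ofReal_step_le_radius hc.c₂_pos.le hc.c₂_le_half hlam hG)
  have hnoise_sum := le_of_mul_le_mul_left (haverage.trans
    (noise_bound_le h.δ_pos hδδ₀ hc.δ₀_lt_one ((div_le_iff₀' (by positivity)).1 hT_ge))) hβ
  obtain ⟨hgrad, hsum⟩ := hdescent.norm_gradient_le_and_sum_le hsmooth h.effSmooth_nonneg hG hβ
    (le_weight hβ hβ₁) (weight_le_one hβ hβ₁) (weight_zero hβ.ne') (by positivity) hlo_le_hi
    (h.lag_le hc hδδ₀) (fun x hx => sub_gap_le h.bddBelow hx)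
    ((le_div_iff₀' two_pos).2 h.two_mul_gradient_le) hnoise_sum (hT ▸ h.budget_le hc)
  exact ⟨hgrad, mean_le_of_descent hlam hG hη (noiseConst_pos δ₀).le h.gap_nonneg h.ε_pos
    (by linarith [hc.le_C₂])
    (mul_noiseConst_mul_le_one hc.le_C₂ hc.c₁_pos.le hc.c₁_le (by norm_num))
    (lt_of_lt_of_le (by positivity) hT_ge) (h.admissible.β_mul_le hc.c₁_pos.le hlam.le)
    (hT ▸ div_le_horizon _ _ _ _ _ _) hsum⟩

theorem ofReal_one_sub_le_measure [MeasurableSpace Ω] [MeasurableSpace Ξ] {μ : Measure Ω}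
    [IsProbabilityMeasure μ] {ξ : ℕ → Ω → Ξ}
    (h : IsTuned f D xinit C₁ c₁ c₂ L₀ Lρ ρ σ lam δ ε G β βsq η)
    (hc : IsConstantChoice δ₀ C₁ C₂ c₁ c₂) (hδδ₀ : δ ≤ δ₀)
    (hg : Measurable fun p : Vec d × Ξ => g p.1 p.2) (hξ : ∀ t, Measurable (ξ t))
    (hN : BoundedNoise μ f g ξ (fun t ω => iterate g β βsq η lam xinit (fun s => ξ s ω) t) σ)
    (hseg : ∀ᵐ ω ∂μ, ∀ t : ℕ, 1 ≤ t →
      segment ℝ (iterate g β βsq η lam xinit (fun s => ξ s ω) t)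
        (iterate g β βsq η lam xinit (fun s => ξ s ω) (t + 1)) ⊆ D)
    {T : ℕ} (hT : T = horizon C₂ (gap f D xinit) G ε β η) :
    ENNReal.ofReal (1 - δ) ≤ μ {ω |
      (∀ t ∈ Finset.Icc 1 T,
        ‖gradient f (iterate g β βsq η lam xinit (fun s => ξ s ω) t)‖ ≤ G) ∧
      1 / (T : ℝ) * ∑ t ∈ Finset.Icc 1 T,
        ‖gradient f (iterate g β βsq η lam xinit (fun s => ξ s ω) t)‖ ^ 2 ≤ ε ^ 2} := by
  have hβ := h.admissible.β_pos
  have hβ₁ := h.admissible.β_le_one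
  have hn := hN.isBoundedMartingaleDiff hg hξ
  have hbad := hn.measure_lt_mul_sum_norm_average_sq_le hβ.le (le_weight hβ hβ₁)
    (weight_le_one hβ hβ₁) (sum_weight_sq_le hβ hβ₁ T)
    (Real.log_nonneg ((one_le_div h.δ_pos).2 (hδδ₀.trans hc.δ₀_lt_one.le)))
  rw [one_div, Real.log_inv, neg_neg, Real.exp_log h.δ_pos] at hbad
  refine AdamConv.ofReal_one_sub_le_measure h.δ_pos.le hbad ?_
  filter_upwards [ae_all_iff.2 hn.bound, hseg] with ω hnoise hsegω hgood
  rw [← Real.log_inv, ← one_div] at hgood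
  obtain ⟨hgrad, hmean⟩ := h.norm_gradient_le_and_mean_le hc hδδ₀ hT hnoise
    (fun k => hsegω (k + 1) k.succ_pos) (not_lt.1 hgood)
  refine ⟨fun t ht => ?_, ?_⟩
  · obtain ⟨ht₁, htT⟩ := Finset.mem_Icc.1 ht
    exact hgrad (t - 1) (by omega)
  · rwa [sum_Icc_iterate g β βsq η lam xinit (fun s => ξ s ω) fun x => ‖gradient f x‖ ^ 2]

end IsTuned

end Convergence

end AdamConv

end

theorem mainTheorem2 (δ₀ : ℝ) (hδ₀ : 0 < δ₀) (hδ₀' : δ₀ < 1) :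
    ∃ C₀ : ℝ, 0 < C₀ ∧ ∀ C₁ C₂ : ℝ, C₀ ≤ C₁ → C₀ ≤ C₂ →
    ∃ c₀ : ℝ, 0 < c₀ ∧ ∀ c₁ c₂ : ℝ, 0 < c₁ → c₁ ≤ c₀ → 0 < c₂ → c₂ ≤ c₀ →
      -- bounded gradients and convergence
      (∀ (d : ℕ) (Ω Ξ : Type*) [MeasurableSpace Ω] [MeasurableSpace Ξ]
        (μ : MeasureTheory.Measure Ω) [MeasureTheory.IsProbabilityMeasure μ]
        (f : AdamConv.Vec d → ℝ) (D : Set (AdamConv.Vec d))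
        (g : AdamConv.Vec d → Ξ → AdamConv.Vec d) (ξ : ℕ → Ω → Ξ) (xinit : AdamConv.Vec d)
        (L₀ Lρ ρ σ lam δ ε G β βsq η : ℝ),
        0 ≤ L₀ → 0 ≤ Lρ → 0 ≤ ρ → ρ < 1 → 0 ≤ σ → 0 < lam → 0 < δ → δ ≤ δ₀ → 0 < ε →
        -- the objective
        IsOpen D → xinit ∈ D → BddBelow (f '' D) →
        AdamConv.IsL0LrhoSmoothOn f D L₀ Lρ ρ →
        -- the stochastic gradients; the run takes place in the domain of `f`
        Measurable (fun p : AdamConv.Vec d × Ξ => g p.1 p.2) → (∀ t, Measurable (ξ t)) →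
        AdamConv.BoundedNoise μ f g ξ
          (fun t ω => AdamConv.iterate g β βsq η lam xinit (fun s => ξ s ω) t) σ →
        (∀ᵐ ω ∂μ, ∀ t : ℕ, 1 ≤ t →
          segment ℝ (AdamConv.iterate g β βsq η lam xinit (fun s => ξ s ω) t)
            (AdamConv.iterate g β βsq η lam xinit (fun s => ξ s ω) (t + 1)) ⊆ D) →
        -- the parameters
        2 * lam ≤ G → 2 * σ ≤ G → 2 * ‖gradient f xinit‖ ≤ G →
        C₁ * AdamConv.gap f D xinit * L₀ / lam ≤ G →
        (C₁ * AdamConv.gap f D xinit * Lρ / lam) ^ (1 / (1 - ρ)) ≤ G →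
        0 ≤ βsq → βsq ≤ 1 →
        AdamConv.Admissible c₁ c₂ δ ε σ lam L₀ Lρ ρ G β η →
        ∀ T : ℕ, T = AdamConv.horizon C₂ (AdamConv.gap f D xinit) G ε β η →
        ENNReal.ofReal (1 - δ) ≤
          μ {ω | (∀ t ∈ Finset.Icc 1 T,
                ‖gradient f (AdamConv.iterate g β βsq η lam xinit (fun s => ξ s ω) t)‖ ≤ G) ∧
              (1 / (T : ℝ)) * ∑ t ∈ Finset.Icc 1 T,
                ‖gradient f (AdamConv.iterate g β βsq η lam xinit (fun s => ξ s ω) t)‖ ^ 2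
                  ≤ ε ^ 2}) ∧
      -- dimension-free complexity of order `ε⁻⁴`: `K` depends on neither `d` nor `ε`
      (∀ L₀ Lρ ρ σ lam δ G Δ₁ : ℝ,
        0 ≤ L₀ → 0 ≤ Lρ → 0 ≤ ρ → ρ < 1 → 0 ≤ σ → 0 < lam → 0 < δ → δ ≤ δ₀ → 0 < G → 0 ≤ Δ₁ →
        ∃ K : ℝ, 0 < K ∧ ∀ ε : ℝ, 0 < ε → ε ≤ 1 →
          ∃ β η : ℝ, AdamConv.Admissible c₁ c₂ δ ε σ lam L₀ Lρ ρ G β η ∧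
            (AdamConv.horizon C₂ Δ₁ G ε β η : ℝ) ≤ K / ε ^ 4) := by
  have hC := AdamConv.noiseConst_pos δ₀
  refine ⟨20000, by norm_num, fun C₁ C₂ hC₁ hC₂ => ?_⟩
  have hC₂_pos : 0 < C₂ := by linarith
  have hscale : 0 < 8 * AdamConv.noiseConst δ₀ * C₂ := by positivity
  refine ⟨1 / (8 * AdamConv.noiseConst δ₀ * C₂), by positivity,
    fun c₁ c₂ hc₁ hc₁' hc₂ hc₂' => ⟨?_, ?_⟩⟩
  · have hc : AdamConv.IsConstantChoice δ₀ C₁ C₂ c₁ c₂ :=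
      ⟨hδ₀', hC₁, hC₂, hc₁, (le_div_iff₀' hscale).1 hc₁', hc₂, (le_div_iff₀' hscale).1 hc₂'⟩
    intro d Ω Ξ _ _ μ _ f D g ξ xinit L₀ Lρ ρ σ lam δ ε G β βsq η hL₀ hLρ hρ hρ₁ hσ hlam hδ hδδ₀ hε
      hD hx hf hsmooth hg hξ hN hseg hlamG hσG hgradG hGL₀ hGLρ hβsq hβsq₁ hadm T hT
    exact AdamConv.IsTuned.ofReal_one_sub_le_measure ⟨hL₀, hLρ, hρ, hρ₁, hσ, hlam, hδ, hε, hD, hx,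
      hf, hsmooth, hlamG, hσG, hgradG, hGL₀, hGLρ, hβsq, hβsq₁, hadm⟩ hc hδδ₀ hg hξ hN hseg hT
  · intro L₀ Lρ ρ σ lam δ G Δ₁ hL₀ _ hρ _ _ hlam _ _ hG hΔ₁
    exact AdamConv.exists_forall_exists_admissible_horizon_le hc₁ hc₂ hC₂_pos.le hL₀ hρ hlam hG hΔ₁
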